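/- **Corollary 4.1.** Let $D=\frac1i(\partial_x,\partial_y)$ on $\mathbb R^2$, let $\sigma_1,\sigma_2,\sigma_3$ be the Pauli matrices, and let $t_0>0$. Let $f_0,f_1:\mathbb R\to\mathbb R$ be continuous and $t_0$-periodic with $\int_0^{t_0}f_j(\tau)\,d\tau=0$, and put $F_j(\tau)=\int_0^\tau f_j(s)\,ds$. Let $v:\mathbb R\to\mathbb R$ be smooth with $v'$ and $v''$ bounded. For $\varepsilon>0$ let $$H_\varepsilon(t)=D\cdot\sigma+\frac1\varepsilon\Big(f_1\big(\tfrac t\varepsilon\big)\sigma_1+f_0\big(\tfrac t\varepsilon\big)v(y)\Big),\qquad U_{-1}(\tau)=e^{-i[F_1(\tau)\sigma_1+F_0(\tau)v(y)]}=e^{-iF_0(\tau)v(y)}\big(\cos F_1(\tau)\,I-i\sin F_1(\tau)\,\sigma_1\big),$$ and write $\langle g\rangle=\frac1{t_0}\int_0^{t_0}g(\tau)\,d\tau$. Then the effective Hamiltonian $\tilde H=\langle U_{-1}^*\,(D\cdot\sigma)\,U_{-1}\rangle$ is given (on smooth compactly supported spinor fields, pointwise) by $$\tilde H=\frac1i\partial_x\sigma_1+Y\,\frac1i\partial_y+M\,v'(y),$$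 $$Y=\langle\cos(2F_1)\rangle\sigma_2-\langle\sin(2F_1)\rangle\sigma_3,\qquad M=-\big(\langle\cos(2F_1)F_0\rangle\sigma_2-\langle\sin(2F_1)F_0\rangle\sigma_3\big).$$ Moreover there is a constant $C$, depending only on $t_0,f_0,f_1,v$, such that the following holds for all $\varepsilon>0$ and all $\varphi\in H^2(\mathbb R^2;\mathbb C^2)$. Let $\psi_\varepsilon,\psi\in C([0,\infty);L^2(\mathbb R^2;\mathbb C^2))$ be solutions (in the distributional sense, tested against $C_c^\infty(\mathbb R^2;\mathbb C^2)$ in the space variables) of $$i\partial_t\psi_\varepsilon=H_\varepsilon(t)\psi_\varepsilon,\qquad i\partial_t\psi=\tilde H\psi,\qquad \psi_\varepsilon(0)=\psi(0)=\varphi .$$ Then $$\big\|\psi_\varepsilon(t)-U_{-1}(\tfrac t\varepsilon)\psi(t)\big\|_{L^2}\le C\,t\,\varepsilon\,\sup_{0\le s\le t}\|\psi(s)\|_{H^2}$$ for every $t\ge t_0$, and also for every $t\in\{n\varepsilon t_0: n=0,1,2,\dots\}$; and for every $t\ge0$, $$\big\|\psi_\varepsilon(t)-U_{-1}(\tfrac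 t\varepsilon)\psi(t)\big\|_{L^2}\le C\,(t_0+t)\,\varepsilon\,\sup_{0\le s\le t}\|\psi(s)\|_{H^2}.$$ (The $H^2$ norm is taken to be $+\infty$ off $H^2$.) -/

import Mathlib

open MeasureTheory Set
open scoped ContDiff ENNReal Matrix

noncomputable section

namespace DrivenDirac

/-- The plane `ℝ²`; a point `z` has coordinates `x = z 0` and `y = z 1`. -/
abbrev Plane : Type := EuclideanSpace ℝ (Fin 2)

/-- Two-component spinors `ℂ²`. -/
abbrev Spinor : Type := EuclideanSpace ℂ (Fin 2)

/-- The Hilbert space `L²(ℝ²; ℂ²)` (Lebesgue measure). -/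
abbrev State : Type := Lp Spinor 2 (volume : Measure Plane)

/-- The Pauli matrix `σ₁`. -/
def pauli1 : Matrix (Fin 2) (Fin 2) ℂ := !![0, 1; 1, 0]

/-- The Pauli matrix `σ₂`. -/
def pauli2 : Matrix (Fin 2) (Fin 2) ℂ := !![0, -Complex.I; Complex.I, 0]

/-- The Pauli matrix `σ₃`. -/
def pauli3 : Matrix (Fin 2) (Fin 2) ℂ := !![1, 0; 0, -1]

/-- The product of a `2 × 2` matrix and a spinor. -/
def act (A : Matrix (Fin 2) (Fin 2) ℂ) (w : Spinor) : Spinor :=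
  Matrix.toEuclideanCLM (n := Fin 2) (𝕜 := ℂ) A w

/-- The classical partial derivative: `∂_x` for `j = 0` and `∂_y` for `j = 1`. -/
def partialDeriv (j : Fin 2) (g : Plane → Spinor) (z : Plane) : Spinor :=
  fderiv ℝ g z (EuclideanSpace.single j 1)

/-- Test functions: the elements of `C_c^∞(ℝ²; ℂ²)`. -/
def IsTestFunction (χ : Plane → Spinor) : Prop :=
  ContDiff ℝ ∞ χ ∧ HasCompactSupport χ

/-- The pairing `∫ ⟨χ(z), g(z)⟩ dz`, conjugate linear in `χ`. -/
def pairing (χ g : Plane → Spinor) : ℂ := ∫ z, inner ℂ (χ z) (g z)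

/-! ### The Sobolev norm of order two -/

/-- `g` is the weak partial derivative of `f` in the direction `j`. -/
def IsWeakPartial (j : Fin 2) (f g : State) : Prop :=
  ∀ χ : Plane → Spinor, IsTestFunction χ → pairing (partialDeriv j χ) f = -pairing χ g

/-- The norm of `H²(ℝ²; ℂ²)`: the square root of the sum of the squares of the `L²` norms of `f`
and of its weak derivatives of order one and two. Weak derivatives are unique, so the infimum is
over at most one family; it is `∞` exactly when some derivative is missing, that is, when `f` does
not belong to `H²`. -/
def h2Norm (f : State) : ℝ≥0∞ :=
  ⨅ (g : Fin 2 → State) (h : Fin 2 → Fin 2 → State)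
    (_ : ∀ j, IsWeakPartial j f (g j)) (_ : ∀ j k, IsWeakPartial k (g j) (h j k)),
    ENNReal.ofReal
      (Real.sqrt (‖f‖ ^ 2 + ∑ j, ‖g j‖ ^ 2 + ∑ j, ∑ k, ‖h j k‖ ^ 2))

/-- Membership in `H²(ℝ²; ℂ²)`. -/
def MemH2 (f : State) : Prop := h2Norm f < ⊤

/-! ### Hamiltonians, as differential operators on smooth spinor fields -/

/-- `D · σ = (1/i) ∂_x σ₁ + (1/i) ∂_y σ₂`. -/
def dirac (g : Plane → Spinor) (z : Plane) : Spinor :=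
  (1 / Complex.I) • act pauli1 (partialDeriv 0 g z)
    + (1 / Complex.I) • act pauli2 (partialDeriv 1 g z)

/-- `H_ε(t) = D · σ + ε⁻¹ (f₁(t/ε) σ₁ + f₀(t/ε) v(y))`. -/
def modulated (f₀ f₁ v : ℝ → ℝ) (ε t : ℝ) (g : Plane → Spinor) (z : Plane) : Spinor :=
  dirac g z + ((1 / ε : ℝ) : ℂ) •
    (((f₁ (t / ε) : ℝ) : ℂ) • act pauli1 (g z) + ((f₀ (t / ε) * v (z 1) : ℝ) : ℂ) • g z)

/-- The antiderivative `F(τ) = ∫_0^τ f(s) ds`. -/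
def antideriv (f : ℝ → ℝ) (τ : ℝ) : ℝ := ∫ s in (0 : ℝ)..τ, f s

/-- The time average `⟨g⟩ = (1/t₀) ∫_0^{t₀} g(τ) dτ`. -/
def timeAverage (t₀ : ℝ) (g : ℝ → ℝ) : ℝ := (1 / t₀) * ∫ τ in (0 : ℝ)..t₀, g τ

/-- The fast unitary `U₋₁(τ) = exp(-i (F₁(τ) σ₁ + F₀(τ) v(y)))
= exp(-i F₀(τ) v(y)) (cos F₁(τ) - i sin F₁(τ) σ₁)`, a multiplication operator. -/
def fastUnitary (f₀ f₁ v : ℝ → ℝ) (τ : ℝ) (z : Plane) : Matrix (Fin 2) (Fin 2) ℂ :=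
  Complex.exp (-Complex.I * ((antideriv f₀ τ * v (z 1) : ℝ) : ℂ)) •
    (((Real.cos (antideriv f₁ τ) : ℝ) : ℂ) • (1 : Matrix (Fin 2) (Fin 2) ℂ)
      - (Complex.I * ((Real.sin (antideriv f₁ τ) : ℝ) : ℂ)) • pauli1)

/-- The conjugated Hamiltonian `U₋₁(τ)* (D · σ) U₋₁(τ)`. -/
def conjugated (f₀ f₁ v : ℝ → ℝ) (τ : ℝ) (g : Plane → Spinor) (z : Plane) : Spinor :=
  act (fastUnitary f₀ f₁ v τ z)ᴴ (dirac (fun w => act (fastUnitary f₀ f₁ v τ w) (g w)) z)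

/-- `Y = ⟨cos 2F₁⟩ σ₂ - ⟨sin 2F₁⟩ σ₃`. -/
def matrixY (t₀ : ℝ) (f₁ : ℝ → ℝ) : Matrix (Fin 2) (Fin 2) ℂ :=
  ((timeAverage t₀ (fun τ => Real.cos (2 * antideriv f₁ τ)) : ℝ) : ℂ) • pauli2
    - ((timeAverage t₀ (fun τ => Real.sin (2 * antideriv f₁ τ)) : ℝ) : ℂ) • pauli3

/-- `M = -(⟨cos(2F₁) F₀⟩ σ₂ - ⟨sin(2F₁) F₀⟩ σ₃)`. -/
def matrixM (t₀ : ℝ) (f₀ f₁ : ℝ → ℝ) : Matrix (Fin 2) (Fin 2) ℂ :=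
  -(((timeAverage t₀ (fun τ => Real.cos (2 * antideriv f₁ τ) * antideriv f₀ τ) : ℝ) : ℂ) • pauli2
    - ((timeAverage t₀ (fun τ => Real.sin (2 * antideriv f₁ τ) * antideriv f₀ τ) : ℝ) : ℂ)
      • pauli3)

/-- The effective Hamiltonian `(1/i) ∂_x σ₁ + Y (1/i) ∂_y + M v'(y)`. -/
def effective (t₀ : ℝ) (f₀ f₁ v : ℝ → ℝ) (g : Plane → Spinor) (z : Plane) : Spinor :=
  (1 / Complex.I) • act pauli1 (partialDeriv 0 g z)
    + (1 / Complex.I) • act (matrixY t₀ f₁) (partialDeriv 1 g z)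
    + ((deriv v (z 1) : ℝ) : ℂ) • act (matrixM t₀ f₀ f₁) (g z)

/-! ### Solutions of the evolution equations -/

/-- `ψ ∈ C([0, ∞); L²)` is the solution of `i ∂_t ψ = H(t) ψ`, `ψ(0) = φ`: the equation is tested
against `C_c^∞`, that is, `i (d/dt) ⟨χ, ψ(t)⟩ = ⟨H(t) χ, ψ(t)⟩` for every test function `χ` and
every `t ≥ 0` (one-sided derivative at `0`). This is the distributional form of the equation for
a formally self-adjoint `H(t)`, as are all the Hamiltonians above. -/
structure IsSolution (H : ℝ → (Plane → Spinor) → Plane → Spinor) (φ : State) (ψ : ℝ → State) :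
    Prop where
  continuousOn : ContinuousOn ψ (Ici 0)
  initial : ψ 0 = φ
  equation : ∀ χ : Plane → Spinor, IsTestFunction χ → ∀ t : ℝ, 0 ≤ t →
    HasDerivWithinAt (fun s => pairing χ (ψ s)) ((1 / Complex.I) * pairing (H t χ) (ψ t)) (Ici 0) t

/-- The error `‖ψ_ε(t) - U₋₁(t/ε) ψ(t)‖` in `L²(ℝ²; ℂ²)`. -/
def averagingError (f₀ f₁ v : ℝ → ℝ) (ε t : ℝ) (ψε ψ : ℝ → State) : ℝ≥0∞ :=
  eLpNorm (fun z => ψε t z - act (fastUnitary f₀ f₁ v (t / ε) z) (ψ t z)) 2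
    (volume : Measure Plane)

end DrivenDirac

end

/-! The fast phase is removed exactly and the remaining Hamiltonian is averaged with one corrector.
Put `u(s) = U₋₁(s/ε)* ψ_ε(s)`. Differentiating `U₋₁` cancels the `1/ε` potential, so `u` is driven
by `U₋₁* (D · σ) U₋₁` alone. As `σ₁` anticommutes with `σ₂` and `σ₃`, this conjugate is a
combination `∑ pₖ(s/ε) Eₖ` of five fixed symmetric operators of order at most one, with real
`t₀`-periodic coefficients (`diracOp_rotationOp`). Averaging the coefficients gives the effective
Hamiltonian `∑ qₖ Eₖ`.

Let `γₖ` be the antiderivative of `pₖ - qₖ` that vanishes at `0`; it is periodic, hence bounded. For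
`e = u - ψ + iε ∑ γₖ(s/ε) Eₖ ψ` the terms of order one cancel, and `i ∂ₜ e = (∑ pₖ Eₖ) e + i r` with
`r = ε ∑ γₖ (qₗ Eₖ Eₗ - pₗ Eₗ Eₖ) ψ`. Two operators fall on `ψ`, which is why the `H²` norm appears.
An energy estimate bounds `e(t)` by `t` times the size of `r`; the corrector itself costs a term of
order `ε` without a factor `t`, which vanishes at multiples of the fast period
(`norm_averaged_sub_le`).

The solutions are only distributional, so the energy identity cannot be used directly. It is applied
after Friedrichs mollification: a mollifier is a symmetric contraction, makes each `Eₖ` bounded, and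
almost commutes with `Eₖ` because `v''` is bounded (`exists_regularizer`). The commutator error
disappears in the limit (`norm_le_of_weak_equation`). -/

noncomputable section

namespace DrivenDirac

/-! ### Weak evolution equations and averaging in an abstract Hilbert space. -/

section Abstract

variable {H T ι : Type*} [NormedAddCommGroup H] [InnerProductSpace ℂ H]
  [AddCommGroup T] [Module ℂ T]

/-- `g` is the image of `f` under the adjoint of the operator `p`, which is defined on the dense
range of `J`. -/
def HasWeakImage (J : T →ₗ[ℂ] H) (p : T →ₗ[ℂ] T) (f g : H) : Prop :=
  ∀ χ, inner ℂ (J (p χ)) f = inner ℂ (J χ) g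

/-- If `p` is bounded on the dense range of `J`, it extends to all of `H`, and the adjoint of the
extension produces the weak images. -/
theorem exists_weakImage_of_bound [CompleteSpace H] {J : T →ₗ[ℂ] H} (hJ : DenseRange J)
    {p : T →ₗ[ℂ] T} {C : ℝ} (hC : 0 ≤ C) (hp : ∀ χ, ‖J (p χ)‖ ≤ C * ‖J χ‖) :
    ∃ B : H →L[ℂ] H, (∀ f, HasWeakImage J p f (B f)) ∧ ∀ f, ‖B f‖ ≤ C * ‖f‖ := by
  refine ⟨ContinuousLinearMap.adjoint ((J ∘ₗ p).extendOfNorm J), fun f χ => ?_, fun f => ?_⟩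
  · rw [ContinuousLinearMap.adjoint_inner_right, LinearMap.extendOfNorm_eq hJ ⟨C, hp⟩]
    rfl
  · refine (ContinuousLinearMap.le_opNorm _ f).trans ?_
    rw [LinearIsometryEquiv.norm_map]
    exact mul_le_mul_of_nonneg_right (LinearMap.opNorm_extendOfNorm_le hJ hC hp) (norm_nonneg f)

theorem norm_sub_le_of_weak_deriv {J : T →ₗ[ℂ] H} (hJ : DenseRange J) {y g : ℝ → H} {t K : ℝ}
    (hy : ∀ χ, ∀ s ∈ Icc 0 t, HasDerivWithinAt (fun s => inner ℂ (J χ) (y s))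
      (inner ℂ (J χ) (g s)) (Icc 0 t) s)
    (hg : ∀ s ∈ Icc 0 t, ‖g s‖ ≤ K) {a b : ℝ} (ha : a ∈ Icc 0 t) (hb : b ∈ Icc 0 t) :
    ‖y b - y a‖ ≤ K * |b - a| := by
  have key : ∀ x : H, ‖inner ℂ x (y b - y a)‖ ≤ K * |b - a| * ‖x‖ := by
    intro x
    refine hJ.induction_on (p := fun x => ‖inner ℂ x (y b - y a)‖ ≤ K * |b - a| * ‖x‖) x
      (isClosed_le (by fun_prop) (by fun_prop)) fun χ => ?_
    have := (convex_Icc (0 : ℝ) t).norm_image_sub_le_of_norm_hasDerivWithin_le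
      (C := ‖J χ‖ * K) (hy χ) (fun s hs => (norm_inner_le_norm _ _).trans
        (mul_le_mul_of_nonneg_left (hg s hs) (norm_nonneg _))) ha hb
    rw [inner_sub_right]
    refine this.trans (le_of_eq ?_)
    rw [Real.norm_eq_abs]; ring
  -- Duality: test the increment against itself and divide by its norm.
  have h := key (y b - y a)
  rw [inner_self_eq_norm_sq_to_K] at h
  simp only [norm_pow, RCLike.norm_ofReal, abs_norm] at h
  rcases (norm_nonneg (y b - y a)).eq_or_lt with h0 | h0
  · rw [← h0]
    exact mul_nonneg ((norm_nonneg _).trans (hg a ha)) (abs_nonneg _)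
  · rw [pow_two] at h
    exact le_of_mul_le_mul_right h h0

/-- The curve `y` need not be differentiable in norm, but it is Lipschitz by the previous lemma.
Hence `y a` may be replaced by a nearby test vector at a cost proportional to `|s - a|`, and the
quadratic term `‖y s - y a‖ ^ 2` is negligible. -/
theorem hasDerivWithinAt_norm_sq_of_weak_deriv {J : T →ₗ[ℂ] H} (hJ : DenseRange J)
    {y g : ℝ → H} {t K : ℝ}
    (hy : ∀ χ, ∀ s ∈ Icc 0 t, HasDerivWithinAt (fun s => inner ℂ (J χ) (y s))
      (inner ℂ (J χ) (g s)) (Icc 0 t) s)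
    (hg : ∀ s ∈ Icc 0 t, ‖g s‖ ≤ K) {a : ℝ} (ha : a ∈ Icc 0 t) :
    HasDerivWithinAt (fun s => ‖y s‖ ^ 2) (2 * (inner ℂ (y a) (g a)).re) (Icc 0 t) a := by
  have hK : 0 ≤ K := (norm_nonneg _).trans (hg a ha)
  rw [hasDerivWithinAt_iff_isLittleO, Asymptotics.isLittleO_iff]
  intro c hc
  -- The budget is `2 * (c / 8 + c / 4) + c / 4 = c`: weak differentiability at `χ`, replacement of
  -- `y a` by `J χ`, and the quadratic term.
  obtain ⟨χ, hχ⟩ : ∃ χ, dist (y a) (J χ) < c / (8 * (K + 1)) :=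
    hJ.exists_dist_lt (y a) (by positivity)
  have h1 := (hasDerivWithinAt_iff_isLittleO.1 (hy χ a ha))
  rw [Asymptotics.isLittleO_iff] at h1
  have h2 := h1 (show 0 < c / 8 by positivity)
  have h3 : ∀ᶠ s in nhdsWithin a (Icc 0 t), |s - a| < c / (4 * (K + 1) ^ 2) := by
    refine nhdsWithin_le_nhds ?_
    have := Metric.ball_mem_nhds a (show 0 < c / (4 * (K + 1) ^ 2) by positivity)
    filter_upwards [this] with s hs
    simpa [Real.dist_eq] using hs
  filter_upwards [h2, h3, self_mem_nhdsWithin] with s hs2 hs3 hs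
  have hd := norm_sub_le_of_weak_deriv hJ hy hg ha hs
  set d := y s - y a with hdd
  have e1 : ‖y s‖ ^ 2 = ‖y a‖ ^ 2 + 2 * (inner ℂ (y a) d).re + ‖d‖ ^ 2 := by
    have : y s = y a + d := by simp [hdd]
    rw [this, @norm_add_sq ℂ]
    rfl
  have e2 : ‖inner ℂ (y a) (d - (s - a) • g a)‖ ≤ c / 8 * |s - a| + c / 4 * |s - a| := by
    have : inner ℂ (y a) (d - (s - a) • g a) = inner ℂ (J χ) (d - (s - a) • g a)
        + inner ℂ (y a - J χ) (d - (s - a) • g a) := by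
      rw [← inner_add_left, add_sub_cancel]
    rw [this]
    refine (norm_add_le _ _).trans (add_le_add ?_ ?_)
    · rw [inner_sub_right, hdd, inner_sub_right, inner_smul_right_eq_smul]
      simpa using hs2
    · refine (norm_inner_le_norm _ _).trans ?_
      have : ‖d - (s - a) • g a‖ ≤ 2 * (K + 1) * |s - a| := by
        refine (norm_sub_le _ _).trans ?_
        rw [norm_smul, Real.norm_eq_abs]
        nlinarith [hg a ha, abs_nonneg (s - a)]
      rw [dist_eq_norm] at hχ
      calc _ ≤ c / (8 * (K + 1)) * (2 * (K + 1) * |s - a|) :=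
            mul_le_mul hχ.le this (norm_nonneg _) (by positivity)
        _ = _ := by field_simp; ring
  have e3 : ‖d‖ ^ 2 ≤ c / 4 * |s - a| := by
    have h4 : ‖d‖ ^ 2 ≤ ((K + 1) * |s - a|) ^ 2 := by
      refine pow_le_pow_left₀ (norm_nonneg _) (hd.trans ?_) 2
      nlinarith [abs_nonneg (s - a)]
    have h5 : (K + 1) ^ 2 * |s - a| ≤ c / 4 := by
      rw [lt_div_iff₀ (by positivity)] at hs3
      linarith
    nlinarith [abs_nonneg (s - a)]
  have e4 : ‖y s‖ ^ 2 - ‖y a‖ ^ 2 - (s - a) • (2 * (inner ℂ (y a) (g a)).re)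
      = 2 * (inner ℂ (y a) (d - (s - a) • g a)).re + ‖d‖ ^ 2 := by
    have : inner ℂ (y a) (d - (s - a) • g a)
        = inner ℂ (y a) d - (s - a) • inner ℂ (y a) (g a) := by
      rw [inner_sub_right (y a) d, inner_smul_right_eq_smul]
    rw [e1, this, Complex.sub_re, Complex.real_smul, Complex.re_ofReal_mul, smul_eq_mul]
    ring
  rw [e4, Real.norm_eq_abs, Real.norm_eq_abs]
  have e5 := (Complex.abs_re_le_norm _).trans e2
  rw [abs_le] at e5 ⊢
  have := sq_nonneg ‖d‖
  constructor <;> nlinarith [abs_nonneg (s - a)]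

/-- The real combination `∑ pₖ Eₖ` of a family of operators. -/
def combination [Fintype ι] (E : ι → T →ₗ[ℂ] T) (p : ι → ℝ) : T →ₗ[ℂ] T :=
  ∑ k, ((p k : ℝ) : ℂ) • E k

theorem inner_combination [Fintype ι] (J : T →ₗ[ℂ] H) (E : ι → T →ₗ[ℂ] T) (p : ι → ℝ) (χ : T)
    (f : H) : inner ℂ (J (combination E p χ)) f = ∑ k, (p k : ℂ) * inner ℂ (J (E k χ)) f := by
  simp only [combination, LinearMap.sum_apply, LinearMap.smul_apply, map_sum, map_smul, sum_inner,
    inner_smul_left, Complex.conj_ofReal]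

/-- A symmetric contraction `s` of the test space that smooths: the operators `Eₖ s` are bounded,
and the commutators `[Eₖ, s]` are small. -/
structure IsRegularizer (J : T →ₗ[ℂ] H) (E : ι → T →ₗ[ℂ] T) (δ : ℝ) (s : T →ₗ[ℂ] T) :
    Prop where
  symm : ∀ χ η, inner ℂ (J (s χ)) (J η) = inner ℂ (J χ) (J (s η))
  bound : ∀ χ, ‖J (s χ)‖ ≤ ‖J χ‖
  smoothing : ∀ k, ∃ C, 0 ≤ C ∧ ∀ χ, ‖J (E k (s χ))‖ ≤ C * ‖J χ‖
  commutator : ∀ k χ, ‖J (E k (s χ)) - J (s (E k χ))‖ ≤ δ * ‖J χ‖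

variable [CompleteSpace H] [Fintype ι]

/-- Energy identity for `S e`, where `S` extends `σ`. The curve `S e` has a bounded weak derivative
because `B k`, which represents `S Eₖ`, is a bounded operator. Only the imaginary part of `⟨S e, B k
e⟩` feeds the energy; symmetry of `Eₖ` reduces it to a commutator, of size `δ`. -/
theorem norm_sq_regularized_le {J : T →ₗ[ℂ] H} (hJ : DenseRange J) {E : ι → T →ₗ[ℂ] T}
    (hE : ∀ k χ η, inner ℂ (J (E k χ)) (J η) = inner ℂ (J χ) (J (E k η)))
    {δ : ℝ} (hδ : 0 ≤ δ) {σ : T →ₗ[ℂ] T} (hσ : IsRegularizer J E δ σ)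
    {S : H →L[ℂ] H} (hS : ∀ f, HasWeakImage J σ f (S f)) (hSn : ∀ f, ‖S f‖ ≤ ‖f‖)
    {e r : ℝ → H} {p : ℝ → ι → ℝ} {t E₀ R Λ : ℝ}
    (hp : ∀ s ∈ Icc 0 t, ∀ k, |p s k| ≤ Λ) (he : ∀ s ∈ Icc 0 t, ‖e s‖ ≤ E₀)
    (hr : ∀ s ∈ Icc 0 t, ‖r s‖ ≤ R) (h0 : e 0 = 0)
    (heq : ∀ χ, ∀ s ∈ Icc 0 t, HasDerivWithinAt (fun s => inner ℂ (J χ) (e s))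
      (-Complex.I * inner ℂ (J (combination E (p s) χ)) (e s) + inner ℂ (J χ) (r s))
      (Icc 0 t) s) {b : ℝ} (hb : b ∈ Icc 0 t) :
    ‖S (e b)‖ ^ 2 ≤ 2 * (Fintype.card ι * Λ * δ * E₀ ^ 2 + E₀ * R) * t := by
  have ht : (0 : ℝ) ∈ Icc 0 t := ⟨le_rfl, hb.1.trans hb.2⟩
  have hE₀ : 0 ≤ E₀ := (norm_nonneg _).trans (he b hb)
  have hR : 0 ≤ R := (norm_nonneg _).trans (hr b hb)
  choose C hC0 hC using hσ.smoothing
  choose B hB hBn using fun k => exists_weakImage_of_bound hJ (p := E k ∘ₗ σ) (hC0 k) (hC k)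
  have hSJ : ∀ χ, S (J χ) = J (σ χ) := by
    intro χ
    refine hJ.eq_of_inner_right ℂ fun η => ?_
    rw [← hS, hσ.symm]
  have hIm : ∀ k f, |(inner ℂ (S f) (B k f)).im| ≤ δ * ‖f‖ ^ 2 := by
    intro k f
    refine hJ.induction_on (p := fun f => |(inner ℂ (S f) (B k f)).im| ≤ δ * ‖f‖ ^ 2) f
      (isClosed_le (by fun_prop) (by fun_prop)) fun η => ?_
    rw [hSJ, ← hB]
    -- Moving one `σ` across leaves the commutator plus the expectation of `Eₖ` at `σ η`, which is
    -- real.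
    have h1 : inner ℂ (J ((E k ∘ₗ σ) (σ η))) (J η)
        = inner ℂ (J (E k (σ (σ η))) - J (σ (E k (σ η)))) (J η)
          + inner ℂ (J (E k (σ η))) (J (σ η)) := by
      rw [inner_sub_left, ← hσ.symm]; simp
    have h2 : (inner ℂ (J (E k (σ η))) (J (σ η))).im = 0 := by
      rw [← Complex.conj_eq_iff_im, inner_conj_symm, hE]
    rw [h1, Complex.add_im, h2, add_zero]
    refine (Complex.abs_im_le_norm _).trans ((norm_inner_le_norm _ _).trans ?_)
    rw [pow_two, ← mul_assoc]
    refine mul_le_mul_of_nonneg_right ((hσ.commutator k _).trans ?_) (norm_nonneg _)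
    exact mul_le_mul_of_nonneg_left (hσ.bound η) hδ
  set g : ℝ → H := fun s => -Complex.I • ∑ k, (p s k : ℂ) • B k (e s) + S (r s) with hgdef
  have hy : ∀ χ, ∀ s ∈ Icc 0 t, HasDerivWithinAt (fun s => inner ℂ (J χ) (S (e s)))
      (inner ℂ (J χ) (g s)) (Icc 0 t) s := by
    intro χ s hs
    have := heq (σ χ) s hs
    have h1 : (fun s => inner ℂ (J χ) (S (e s))) = fun s => inner ℂ (J (σ χ)) (e s) := by
      funext s; rw [hS]
    rw [h1]
    convert this using 1
    rw [hgdef, inner_add_right, inner_smul_right, inner_sum, inner_combination, hS]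
    congr 2
    refine Finset.sum_congr rfl fun k _ => ?_
    rw [inner_smul_right, ← hB]; rfl
  have hg : ∀ s ∈ Icc 0 t, ‖g s‖ ≤ (∑ k, Λ * (C k * E₀)) + R := by
    intro s hs
    refine (norm_add_le _ _).trans (add_le_add ?_ ((hSn _).trans (hr s hs)))
    rw [norm_smul, norm_neg, Complex.norm_I, one_mul]
    refine (norm_sum_le _ _).trans (Finset.sum_le_sum fun k _ => ?_)
    rw [norm_smul, Complex.norm_real, Real.norm_eq_abs]
    refine mul_le_mul (hp s hs k) ((hBn k _).trans ?_) (norm_nonneg _)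
      ((abs_nonneg _).trans (hp s hs k))
    exact mul_le_mul_of_nonneg_left (he s hs) (hC0 k)
  have hd := fun a (ha : a ∈ Icc 0 t) => hasDerivWithinAt_norm_sq_of_weak_deriv hJ hy hg ha
  have hbound : ∀ a ∈ Icc 0 t, ‖2 * (inner ℂ (S (e a)) (g a)).re‖
      ≤ 2 * (Fintype.card ι * Λ * δ * E₀ ^ 2 + E₀ * R) := by
    intro a ha
    rw [norm_mul, Real.norm_eq_abs, Real.norm_eq_abs, abs_two]
    refine mul_le_mul_of_nonneg_left ?_ zero_le_two
    rw [hgdef, inner_add_right, inner_smul_right, Complex.add_re]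
    refine (abs_add_le _ _).trans (add_le_add ?_ ?_)
    · have h1 : (-Complex.I * inner ℂ (S (e a)) (∑ k, (p a k : ℂ) • B k (e a))).re
          = ∑ k, p a k * (inner ℂ (S (e a)) (B k (e a))).im := by
        rw [inner_sum, Finset.mul_sum, Complex.re_sum]
        refine Finset.sum_congr rfl fun k _ => ?_
        rw [inner_smul_right]
        simp
      rw [h1]
      refine (Finset.abs_sum_le_sum_abs _ _).trans ?_
      calc _ ≤ ∑ _k : ι, Λ * (δ * E₀ ^ 2) := by
            refine Finset.sum_le_sum fun k _ => ?_
            rw [abs_mul]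
            refine mul_le_mul (hp a ha k) ((hIm k _).trans ?_) (abs_nonneg _)
              ((abs_nonneg _).trans (hp a ha k))
            exact mul_le_mul_of_nonneg_left
              (pow_le_pow_left₀ (norm_nonneg _) (he a ha) 2) hδ
        _ = _ := by simp; ring
    · refine (Complex.abs_re_le_norm _).trans ((norm_inner_le_norm _ _).trans ?_)
      exact mul_le_mul ((hSn _).trans (he a ha)) ((hSn _).trans (hr a ha)) (norm_nonneg _) hE₀
  have := (convex_Icc (0 : ℝ) t).norm_image_sub_le_of_norm_hasDerivWithin_le hd hbound ht hb
  simp only [h0, map_zero, norm_zero, sub_zero] at this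
  rw [Real.norm_eq_abs, Real.norm_eq_abs, abs_of_nonneg hb.1] at this
  have h4 := (le_abs_self _).trans this
  norm_num at h4
  refine h4.trans (mul_le_mul_of_nonneg_left hb.2 ?_)
  exact (norm_nonneg _).trans (hbound 0 ht)

/-- A weak solution of `i ∂ₜ e = (∑ pₖ Eₖ) e + i r` that vanishes at time zero is controlled by
the forcing. -/
theorem norm_le_of_weak_equation {J : T →ₗ[ℂ] H} (hJ : DenseRange J) {E : ι → T →ₗ[ℂ] T}
    (hE : ∀ k χ η, inner ℂ (J (E k χ)) (J η) = inner ℂ (J χ) (J (E k η)))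
    (hreg : ∀ δ : ℝ, 0 < δ → ∀ χ, ∃ σ, IsRegularizer J E δ σ ∧ ‖J (σ χ) - J χ‖ ≤ δ)
    {e r : ℝ → H} {p : ℝ → ι → ℝ} {t E₀ R Λ : ℝ} (ht : 0 ≤ t)
    (hp : ∀ s ∈ Icc 0 t, ∀ k, |p s k| ≤ Λ) (he : ∀ s ∈ Icc 0 t, ‖e s‖ ≤ E₀)
    (hr : ∀ s ∈ Icc 0 t, ‖r s‖ ≤ R) (h0 : e 0 = 0)
    (heq : ∀ χ, ∀ s ∈ Icc 0 t, HasDerivWithinAt (fun s => inner ℂ (J χ) (e s))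
      (-Complex.I * inner ℂ (J (combination E (p s) χ)) (e s) + inner ℂ (J χ) (r s))
      (Icc 0 t) s) :
    ‖e t‖ ≤ 2 * t * R := by
  have ht' : t ∈ Icc 0 t := ⟨ht, le_rfl⟩
  have hR : 0 ≤ R := (norm_nonneg _).trans (hr t ht')
  -- Any a priori bound `E₁` on `e` improves to `√(2 t R E₁)`: mollify, apply the energy bound and
  -- let `δ → 0`. The mollifier depends on the point `b` through `χ`, but the bound does not.
  have improve : ∀ E₁ : ℝ, (∀ s ∈ Icc 0 t, ‖e s‖ ≤ E₁) → ∀ b ∈ Icc 0 t,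
      ‖e b‖ ≤ √(2 * t * R * E₁) := by
    intro E₁ hE₁ b hb
    have hpt : ∀ δ : ℝ, 0 < δ →
        ‖e b‖ ≤ √(2 * (Fintype.card ι * Λ * δ * E₁ ^ 2 + E₁ * R) * t) + 3 * δ := by
      intro δ hδ
      obtain ⟨χ, hχ⟩ : ∃ χ, dist (e b) (J χ) < δ := hJ.exists_dist_lt (e b) hδ
      obtain ⟨σ, hσ, hσχ⟩ := hreg δ hδ χ
      obtain ⟨S, hS, hSn⟩ := exists_weakImage_of_bound hJ (p := σ) zero_le_one
        (by simpa using hσ.bound)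
      simp only [one_mul] at hSn
      have h1 := norm_sq_regularized_le hJ hE hδ.le hσ hS hSn hp hE₁ hr h0 heq hb
      have h2 : S (J χ) = J (σ χ) := by
        refine hJ.eq_of_inner_right ℂ fun η => ?_
        rw [← hS, hσ.symm]
      have h3 : e b = S (e b) + (e b - J χ) - S (e b - J χ) - (J (σ χ) - J χ) := by
        rw [map_sub, h2]; abel
      have h4 : ‖e b - J χ‖ ≤ δ := by rw [← dist_eq_norm]; exact hχ.le
      have h5 := (hSn (e b - J χ)).trans h4
      have h6 := Real.le_sqrt_of_sq_le h1
      calc ‖e b‖ = ‖S (e b) + (e b - J χ) - S (e b - J χ) - (J (σ χ) - J χ)‖ := by rw [← h3]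
        _ ≤ ‖S (e b)‖ + ‖e b - J χ‖ + ‖S (e b - J χ)‖ + ‖J (σ χ) - J χ‖ :=
          (norm_sub_le _ _).trans (add_le_add_left ((norm_sub_le _ _).trans
            (add_le_add_left (norm_add_le _ _) _)) _)
        _ ≤ _ := by linarith
    have hlim : Filter.Tendsto
        (fun δ : ℝ => √(2 * (Fintype.card ι * Λ * δ * E₁ ^ 2 + E₁ * R) * t) + 3 * δ)
        (nhdsWithin 0 (Ioi 0)) (nhds (√(2 * t * R * E₁))) := by
      have : Continuous
          (fun δ : ℝ => √(2 * (Fintype.card ι * Λ * δ * E₁ ^ 2 + E₁ * R) * t) + 3 * δ) := by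
        fun_prop
      have h := (this.tendsto 0).mono_left (nhdsWithin_le_nhds (s := Ioi 0))
      convert h using 2
      simp
      ring_nf
    exact ge_of_tendsto hlim (eventually_nhdsWithin_of_forall fun δ hδ => hpt δ hδ)
  set A : Set ℝ := (fun s => ‖e s‖) '' Icc 0 t
  have hA : BddAbove A := ⟨E₀, by rintro _ ⟨s, hs, rfl⟩; exact he s hs⟩
  have hAne : A.Nonempty := ⟨_, t, ht', rfl⟩
  have hle : ∀ s ∈ Icc 0 t, ‖e s‖ ≤ sSup A := fun s hs => le_csSup hA ⟨s, hs, rfl⟩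
  -- The improvement applied to the best bound gives `(sSup A) ^ 2 ≤ 2 t R sSup A`; this replaces a
  -- Gronwall argument.
  have h1 : sSup A ≤ √(2 * t * R * sSup A) :=
    csSup_le hAne (by rintro _ ⟨s, hs, rfl⟩; exact improve _ hle s hs)
  have hA0 : 0 ≤ sSup A := (norm_nonneg _).trans (hle t ht')
  refine (hle t ht').trans ?_
  rcases hA0.eq_or_lt with h | h
  · rw [← h]; positivity
  · have h2 := (Real.le_sqrt' h).1 h1
    nlinarith

/-- The corrector `iε ∑ γₖ Eₖ ψ` has a time derivative whose leading part is `i (∑ (pₖ - qₖ) Eₖ) ψ`,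
exactly the mismatch between the two evolutions. What remains is `O(ε)` with two operators applied
to `ψ`. The factor `4 (card ι) ^ 2` combines the `2 t` of the energy estimate with the `2 Λ N` from
each pair of operators. -/
theorem norm_averaged_sub_le {J : T →ₗ[ℂ] H} (hJ : DenseRange J) {E : ι → T →ₗ[ℂ] T}
    (hE : ∀ k χ η, inner ℂ (J (E k χ)) (J η) = inner ℂ (J χ) (J (E k η)))
    (hreg : ∀ δ : ℝ, 0 < δ → ∀ χ, ∃ σ, IsRegularizer J E δ σ ∧ ‖J (σ χ) - J χ‖ ≤ δ)
    {p γ : ℝ → ι → ℝ} {q : ι → ℝ} {Λ Γ : ℝ}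
    (hp : ∀ τ k, |p τ k| ≤ Λ) (hq : ∀ k, |q k| ≤ Λ) (hγ : ∀ τ k, |γ τ k| ≤ Γ)
    (hγ' : ∀ τ k, HasDerivAt (fun τ => γ τ k) (p τ k - q k) τ) (hγ0 : ∀ k, γ 0 k = 0)
    {u ψ : ℝ → H} {t N ε E₀ : ℝ} (ht : 0 ≤ t) (hε : 0 < ε)
    (hu : ∀ s ∈ Icc 0 t, ‖u s‖ ≤ E₀) (hψ : ∀ s ∈ Icc 0 t, ‖ψ s‖ ≤ E₀) (h0 : u 0 = ψ 0)
    (hueq : ∀ χ, ∀ s ∈ Icc 0 t, HasDerivWithinAt (fun s => inner ℂ (J χ) (u s))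
      (-Complex.I * inner ℂ (J (combination E (p (s / ε)) χ)) (u s)) (Icc 0 t) s)
    (hψeq : ∀ χ, ∀ s ∈ Icc 0 t, HasDerivWithinAt (fun s => inner ℂ (J χ) (ψ s))
      (-Complex.I * inner ℂ (J (combination E q χ)) (ψ s)) (Icc 0 t) s)
    (hN : ∀ s ∈ Icc 0 t, ∀ k, ∃ g, ‖g‖ ≤ N ∧ HasWeakImage J (E k) (ψ s) g)
    (hN' : ∀ s ∈ Icc 0 t, ∀ k l, ∃ g, ‖g‖ ≤ N ∧ HasWeakImage J (E k ∘ₗ E l) (ψ s) g) :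
    ‖u t - ψ t‖ ≤ 4 * (Fintype.card ι) ^ 2 * Λ * Γ * N * (t * ε) + ε * N * ∑ k, |γ (t / ε) k| := by
  have hι : ∀ s ∈ Icc 0 t, ∃ (g : ι → H) (h : ι → ι → H), (∀ k, ‖g k‖ ≤ N) ∧
      (∀ k, HasWeakImage J (E k) (ψ s) (g k)) ∧ (∀ k l, ‖h k l‖ ≤ N) ∧
      (∀ k l, HasWeakImage J (E k ∘ₗ E l) (ψ s) (h k l)) := by
    intro s hs
    choose g hg hg' using hN s hs
    choose h hh hh' using hN' s hs
    exact ⟨g, h, hg, hg', hh, hh'⟩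
  -- The choices carry no regularity in `s`, and none is needed: the energy estimate uses only
  -- bounds and derivatives of pairings.
  choose! g h hg hgw hh hhw using hι
  set e : ℝ → H := fun s => u s - ψ s
    + (Complex.I * (ε : ℂ)) • ∑ k, (γ (s / ε) k : ℂ) • g s k with hedef
  set r : ℝ → H := fun s => (ε : ℂ) • ∑ k, (γ (s / ε) k : ℂ) •
    ∑ l, ((q l : ℂ) • h s l k - (p (s / ε) l : ℂ) • h s k l) with hrdef
  have ht' : t ∈ Icc 0 t := ⟨ht, le_rfl⟩
  have h0' : (0 : ℝ) ∈ Icc 0 t := ⟨le_rfl, ht⟩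
  have hsum : ∀ s ∈ Icc 0 t, ‖(Complex.I * (ε : ℂ)) • ∑ k, (γ (s / ε) k : ℂ) • g s k‖
      ≤ ε * N * ∑ k, |γ (s / ε) k| := by
    intro s hs
    rw [norm_smul, norm_mul, Complex.norm_I, one_mul, Complex.norm_real, Real.norm_eq_abs,
      abs_of_pos hε, mul_assoc]
    refine mul_le_mul_of_nonneg_left ?_ hε.le
    rw [Finset.mul_sum]
    refine (norm_sum_le _ _).trans (Finset.sum_le_sum fun k _ => ?_)
    rw [norm_smul, Complex.norm_real, Real.norm_eq_abs, mul_comm]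
    exact mul_le_mul_of_nonneg_right (hg s hs k) (abs_nonneg _)
  have he : ∀ s ∈ Icc 0 t, ‖e s‖ ≤ E₀ + E₀ + ε * |N| * ∑ _k : ι, Γ := by
    intro s hs
    refine (norm_add_le _ _).trans (add_le_add ((norm_sub_le _ _).trans
      (add_le_add (hu s hs) (hψ s hs))) ((hsum s hs).trans ?_))
    refine mul_le_mul (mul_le_mul_of_nonneg_left (le_abs_self _) hε.le)
      (Finset.sum_le_sum fun k _ => hγ _ k) (Finset.sum_nonneg fun k _ => abs_nonneg _) ?_
    positivity
  have hr : ∀ s ∈ Icc 0 t, ‖r s‖ ≤ ε * ∑ _k : ι, Γ * ∑ _l : ι, (Λ * N + Λ * N) := by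
    intro s hs
    rw [hrdef, norm_smul, Complex.norm_real, Real.norm_eq_abs, abs_of_pos hε]
    refine mul_le_mul_of_nonneg_left ?_ hε.le
    refine (norm_sum_le _ _).trans (Finset.sum_le_sum fun k _ => ?_)
    rw [norm_smul, Complex.norm_real, Real.norm_eq_abs]
    refine mul_le_mul (hγ _ k) ?_ (norm_nonneg _) ((abs_nonneg _).trans (hγ 0 k))
    refine (norm_sum_le _ _).trans (Finset.sum_le_sum fun l _ => ?_)
    refine (norm_sub_le _ _).trans (add_le_add ?_ ?_)
    · rw [norm_smul, Complex.norm_real, Real.norm_eq_abs]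
      exact mul_le_mul (hq l) (hh s hs l k) (norm_nonneg _) ((abs_nonneg _).trans (hq l))
    · rw [norm_smul, Complex.norm_real, Real.norm_eq_abs]
      exact mul_le_mul (hp _ l) (hh s hs k l) (norm_nonneg _) ((abs_nonneg _).trans (hq l))
  have he0 : e 0 = 0 := by simp [hedef, h0, hγ0]
  have heq : ∀ χ, ∀ s ∈ Icc 0 t, HasDerivWithinAt (fun s => inner ℂ (J χ) (e s))
      (-Complex.I * inner ℂ (J (combination E (p (s / ε)) χ)) (e s) + inner ℂ (J χ) (r s))
      (Icc 0 t) s := by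
    intro χ s hs
    have h1 : ∀ k, HasDerivWithinAt (fun s => (γ (s / ε) k : ℂ) * inner ℂ (J (E k χ)) (ψ s))
        ((((p (s / ε) k - q k) * ε⁻¹ : ℝ) : ℂ) * inner ℂ (J (E k χ)) (ψ s)
          + (γ (s / ε) k : ℂ) *
            (-Complex.I * inner ℂ (J (combination E q (E k χ))) (ψ s))) (Icc 0 t) s := by
      intro k
      have hdiv : HasDerivAt (fun s : ℝ => s / ε) ε⁻¹ s := by
        simpa using (hasDerivAt_id s).div_const ε
      have h2 := (hγ' (s / ε) k).comp s hdiv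
      exact h2.ofReal_comp.hasDerivWithinAt.mul (hψeq (E k χ) s hs)
    have h2 := ((hueq χ s hs).sub (hψeq χ s hs)).add
      ((HasDerivWithinAt.fun_sum (u := Finset.univ) fun k _ => h1 k).const_mul
        (Complex.I * (ε : ℂ)))
    -- In the pairing with `χ` the operator `Eₖ` moves onto the test vector, so the corrector can be
    -- differentiated through the weak equation of `ψ` tested against `Eₖ χ`.
    have h3 : ∀ s ∈ Icc 0 t, inner ℂ (J χ) (e s) = inner ℂ (J χ) (u s) - inner ℂ (J χ) (ψ s)
        + Complex.I * (ε : ℂ) * ∑ k, (γ (s / ε) k : ℂ) * inner ℂ (J (E k χ)) (ψ s) := by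
      intro s hs
      rw [hedef, inner_add_right, inner_sub_right, inner_smul_right, inner_sum]
      congr 2
      refine Finset.sum_congr rfl fun k _ => ?_
      rw [inner_smul_right, hgw s hs k]
    refine (h2.congr h3 (h3 s hs)).congr_deriv ?_
    have hεc : (ε : ℂ) ≠ 0 := by exact_mod_cast hε.ne'
    have a1 : ∀ k, inner ℂ (J (combination E (p (s / ε)) χ)) (g s k)
        = ∑ l, (p (s / ε) l : ℂ) * inner ℂ (J χ) (h s k l) := by
      intro k
      rw [inner_combination]
      refine Finset.sum_congr rfl fun l _ => ?_
      rw [← hgw s hs k, ← hhw s hs k l]; rfl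
    have a2 : ∀ k, inner ℂ (J (combination E q (E k χ))) (ψ s)
        = ∑ l, (q l : ℂ) * inner ℂ (J χ) (h s l k) := by
      intro k
      rw [inner_combination]
      refine Finset.sum_congr rfl fun l _ => ?_
      rw [← hhw s hs l k]; rfl
    have a3 : inner ℂ (J χ) (r s) = (ε : ℂ) * (∑ k, (γ (s / ε) k : ℂ) *
          ∑ l, (q l : ℂ) * inner ℂ (J χ) (h s l k))
        - (ε : ℂ) * ∑ k, (γ (s / ε) k : ℂ) *
          ∑ l, (p (s / ε) l : ℂ) * inner ℂ (J χ) (h s k l) := by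
      rw [hrdef, inner_smul_right, inner_sum, ← mul_sub, ← Finset.sum_sub_distrib]
      congr 1
      refine Finset.sum_congr rfl fun k _ => ?_
      rw [inner_smul_right, inner_sum, ← mul_sub, ← Finset.sum_sub_distrib]
      congr 1
      refine Finset.sum_congr rfl fun l _ => ?_
      rw [inner_sub_right, inner_smul_right, inner_smul_right]
    have a4 : inner ℂ (J (combination E (p (s / ε)) χ)) (e s)
        = inner ℂ (J (combination E (p (s / ε)) χ)) (u s)
          - inner ℂ (J (combination E (p (s / ε)) χ)) (ψ s)
          + Complex.I * (ε : ℂ) * ∑ k, (γ (s / ε) k : ℂ) *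
            ∑ l, (p (s / ε) l : ℂ) * inner ℂ (J χ) (h s k l) := by
      rw [hedef, inner_add_right, inner_sub_right, inner_smul_right, inner_sum]
      congr 2
      refine Finset.sum_congr rfl fun k _ => ?_
      rw [inner_smul_right, a1]
    have a5 : ∑ k, ((((p (s / ε) k - q k) * ε⁻¹ : ℝ) : ℂ) * inner ℂ (J (E k χ)) (ψ s)
          + (γ (s / ε) k : ℂ) *
            (-Complex.I * inner ℂ (J (combination E q (E k χ))) (ψ s)))
        = (ε : ℂ)⁻¹ * (inner ℂ (J (combination E (p (s / ε)) χ)) (ψ s)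
            - inner ℂ (J (combination E q χ)) (ψ s))
          - Complex.I * ∑ k, (γ (s / ε) k : ℂ) *
            ∑ l, (q l : ℂ) * inner ℂ (J χ) (h s l k) := by
      rw [inner_combination, inner_combination, ← Finset.sum_sub_distrib, Finset.mul_sum,
        Finset.mul_sum, ← Finset.sum_sub_distrib]
      refine Finset.sum_congr rfl fun k _ => ?_
      rw [a2]
      push_cast
      ring
    rw [a3, a4, a5]
    have : (ε : ℂ) * (ε : ℂ)⁻¹ = 1 := mul_inv_cancel₀ hεc
    linear_combination (Complex.I * (inner ℂ (J (combination E (p (s / ε)) χ)) (ψ s)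
            - inner ℂ (J (combination E q χ)) (ψ s))) * this +
      (-(ε : ℂ) * (∑ k, (γ (s / ε) k : ℂ) *
          ∑ l, (q l : ℂ) * inner ℂ (J χ) (h s l k)) + (ε : ℂ) * ∑ k, (γ (s / ε) k : ℂ) *
          ∑ l, (p (s / ε) l : ℂ) * inner ℂ (J χ) (h s k l)) * Complex.I_mul_I
  have hfin := norm_le_of_weak_equation hJ hE hreg ht (fun s _ k => hp (s / ε) k) he hr he0 heq
  have : u t - ψ t = e t - (Complex.I * (ε : ℂ)) • ∑ k, (γ (t / ε) k : ℂ) • g t k := by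
    simp [hedef]
  rw [this]
  refine (norm_sub_le _ _).trans (add_le_add (hfin.trans (le_of_eq ?_)) (hsum t ht'))
  simp
  ring

end Abstract

/-! ### Matrices acting on spinors. -/

section Action

theorem act_add (A : Matrix (Fin 2) (Fin 2) ℂ) (x y : Spinor) : act A (x + y) = act A x + act A y :=
  map_add _ _ _

theorem act_sub (A : Matrix (Fin 2) (Fin 2) ℂ) (x y : Spinor) : act A (x - y) = act A x - act A y :=
  map_sub _ _ _

theorem act_smul (A : Matrix (Fin 2) (Fin 2) ℂ) (c : ℂ) (x : Spinor) :
    act A (c • x) = c • act A x :=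
  map_smul _ _ _

theorem act_zero (A : Matrix (Fin 2) (Fin 2) ℂ) : act A 0 = 0 :=
  map_zero _

theorem sub_act (A B : Matrix (Fin 2) (Fin 2) ℂ) (x : Spinor) :
    act (A - B) x = act A x - act B x := by
  simp [act]

theorem neg_act (A : Matrix (Fin 2) (Fin 2) ℂ) (x : Spinor) : act (-A) x = -act A x := by
  simp [act]

theorem smul_act (c : ℂ) (A : Matrix (Fin 2) (Fin 2) ℂ) (x : Spinor) :
    act (c • A) x = c • act A x := by
  simp [act]

theorem one_act (x : Spinor) : act 1 x = x := by
  simp [act]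

theorem mul_act (A B : Matrix (Fin 2) (Fin 2) ℂ) (x : Spinor) :
    act (A * B) x = act A (act B x) := by
  simp [act]

theorem inner_act (A : Matrix (Fin 2) (Fin 2) ℂ) (x y : Spinor) :
    inner ℂ (act A x) y = inner ℂ x (act Aᴴ y) := by
  have : Matrix.toEuclideanCLM (n := Fin 2) (𝕜 := ℂ) Aᴴ
      = ContinuousLinearMap.adjoint (Matrix.toEuclideanCLM (n := Fin 2) (𝕜 := ℂ) A) := by
    rw [← ContinuousLinearMap.star_eq_adjoint, ← map_star]
    rfl
  rw [act, act, this, ContinuousLinearMap.adjoint_inner_right]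

theorem norm_act_le (A : Matrix (Fin 2) (Fin 2) ℂ) (x : Spinor) :
    ‖act A x‖ ≤ ‖Matrix.toEuclideanCLM (n := Fin 2) (𝕜 := ℂ) A‖ * ‖x‖ :=
  ContinuousLinearMap.le_opNorm _ x

end Action

/-! ### Test functions in `L²` and the elementary operators on them. -/

section TestSpace

/-- The space `C_c^∞(ℝ²; ℂ²)`. -/
def testSpace : Submodule ℂ (Plane → Spinor) where
  carrier := {χ | IsTestFunction χ}
  zero_mem' := ⟨contDiff_const, HasCompactSupport.zero⟩
  add_mem' := fun hf hg => ⟨hf.1.add hg.1, hf.2.add hg.2⟩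
  smul_mem' := fun c f hf => ⟨contDiff_const.smul hf.1,
    hf.2.mono (Function.support_const_smul_subset c f)⟩

theorem test_contDiff (χ : testSpace) : ContDiff ℝ ∞ (χ : Plane → Spinor) := χ.2.1

theorem test_continuous (χ : testSpace) : Continuous (χ : Plane → Spinor) := χ.2.1.continuous

theorem test_hasCompactSupport (χ : testSpace) :
    HasCompactSupport (χ : Plane → Spinor) := χ.2.2

theorem test_differentiable (χ : testSpace) : Differentiable ℝ (χ : Plane → Spinor) :=
  χ.2.1.differentiable (by simp)

theorem test_memLp (χ : testSpace) : MemLp (χ : Plane → Spinor) 2 volume :=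
  (test_continuous χ).memLp_of_hasCompactSupport (test_hasCompactSupport χ)

/-- The embedding of the test functions into `L²`. -/
def toState : testSpace →ₗ[ℂ] State where
  toFun χ := (test_memLp χ).toLp
  map_add' _ _ := rfl
  map_smul' _ _ := rfl

theorem coeFn_toState (χ : testSpace) : toState χ =ᵐ[volume] (χ : Plane → Spinor) :=
  (test_memLp χ).coeFn_toLp

theorem denseRange_toState : DenseRange toState := by
  have h := Lp.dense_hasCompactSupport_contDiff (F := Spinor) (E := Plane)
    (μ := (volume : Measure Plane)) (p := 2) (by simp)
  refine h.mono ?_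
  rintro f ⟨g, hfg, hg, hg'⟩
  refine ⟨⟨g, hg', hg⟩, ?_⟩
  exact Lp.ext ((coeFn_toState _).trans hfg.symm)

theorem inner_toState (χ : testSpace) (f : State) : inner ℂ (toState χ) f = pairing χ f := by
  rw [L2.inner_def]
  refine integral_congr_ae ?_
  filter_upwards [coeFn_toState χ] with z hz
  rw [hz]

theorem inner_toState_toState (χ η : testSpace) :
    inner ℂ (toState χ) (toState η) = pairing χ η := by
  rw [inner_toState]
  refine integral_congr_ae ?_
  filter_upwards [coeFn_toState η] with z hz
  rw [hz]

theorem norm_toState_le {χ η : testSpace} {C : ℝ} (h : ∀ z, ‖χ.1 z‖ ≤ C * ‖η.1 z‖) :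
    ‖toState χ‖ ≤ C * ‖toState η‖ := by
  refine Lp.norm_le_mul_norm_of_ae_le_mul ?_
  filter_upwards [coeFn_toState χ, coeFn_toState η] with z h1 h2
  rw [h1, h2]
  exact h z

/-- The operator `∂_j` on test functions. -/
def derivOp (j : Fin 2) : testSpace →ₗ[ℂ] testSpace where
  toFun χ := ⟨partialDeriv j χ,
    ⟨((test_contDiff χ).fderiv_right (m := ∞) (by simp)).clm_apply contDiff_const,
      (test_hasCompactSupport χ).fderiv_apply (𝕜 := ℝ) _⟩⟩
  map_add' χ η := by
    ext1; funext z
    change fderiv ℝ (χ.1 + η.1) z _ = fderiv ℝ χ.1 z _ + fderiv ℝ η.1 z _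
    rw [fderiv_add (test_differentiable χ z) ((test_differentiable η) z)]
    rfl
  map_smul' c χ := by
    ext1; funext z
    change fderiv ℝ (c • χ.1) z _ = c • fderiv ℝ χ.1 z _
    rw [fderiv_const_smul (test_differentiable χ z)]
    rfl

/-- Multiplication of test functions by a smooth scalar function. -/
def mulOp (m : Plane → ℂ) (hm : ContDiff ℝ ∞ m) : testSpace →ₗ[ℂ] testSpace where
  toFun χ := ⟨fun z => m z • χ.1 z, ⟨hm.smul (test_contDiff χ),
    (test_hasCompactSupport χ).mono (Function.support_smul_subset_right m χ.1)⟩⟩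
  map_add' χ η := by ext1; funext z; exact smul_add _ _ _
  map_smul' c χ := by ext1; funext z; exact smul_comm (m z) c (χ.1 z)

/-- Multiplication of test functions by a constant matrix. -/
def matOp (A : Matrix (Fin 2) (Fin 2) ℂ) : testSpace →ₗ[ℂ] testSpace where
  toFun χ := ⟨fun z => act A (χ.1 z),
    ⟨((Matrix.toEuclideanCLM (n := Fin 2) (𝕜 := ℂ) A).restrictScalars ℝ).contDiff.comp (test_contDiff χ),
      (test_hasCompactSupport χ).comp_left (act_zero A)⟩⟩
  map_add' χ η := by ext1; funext z; exact act_add _ _ _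
  map_smul' c χ := by ext1; funext z; exact act_smul _ _ _

theorem matOp_smul (c : ℂ) (A : Matrix (Fin 2) (Fin 2) ℂ) : matOp (c • A) = c • matOp A := by
  ext1 χ; ext1; funext z; exact smul_act c A _

theorem matOp_matOp (A B : Matrix (Fin 2) (Fin 2) ℂ) (χ : testSpace) :
    matOp A (matOp B χ) = matOp (A * B) χ := by
  ext1; funext z; exact (mul_act A B _).symm

theorem partialDeriv_act (A : Matrix (Fin 2) (Fin 2) ℂ) (j : Fin 2) {g : Plane → Spinor}
    {z : Plane} (hg : DifferentiableAt ℝ g z) :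
    partialDeriv j (fun w => act A (g w)) z = act A (partialDeriv j g z) := by
  have h := (((Matrix.toEuclideanCLM (n := Fin 2) (𝕜 := ℂ) A).restrictScalars ℝ).hasFDerivAt
    (x := g z)).comp z hg.hasFDerivAt
  have h2 : fderiv ℝ (fun w => act A (g w)) z = _ := h.fderiv
  rw [partialDeriv, h2]
  rfl

theorem partialDeriv_smul (j : Fin 2) {m : Plane → ℂ} {g : Plane → Spinor} {z : Plane}
    (hm : DifferentiableAt ℝ m z) (hg : DifferentiableAt ℝ g z) :
    partialDeriv j (fun w => m w • g w) z = m z • partialDeriv j g z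
      + fderiv ℝ m z (EuclideanSpace.single j 1) • g z := by
  rw [partialDeriv, fderiv_fun_smul hm hg]
  rfl

theorem derivOp_matOp (j : Fin 2) (A : Matrix (Fin 2) (Fin 2) ℂ) (χ : testSpace) :
    derivOp j (matOp A χ) = matOp A (derivOp j χ) := by
  ext1; funext z
  exact partialDeriv_act A j (test_differentiable χ z)

theorem mulOp_matOp (m : Plane → ℂ) (hm : ContDiff ℝ ∞ m) (A : Matrix (Fin 2) (Fin 2) ℂ)
    (χ : testSpace) : mulOp m hm (matOp A χ) = matOp A (mulOp m hm χ) := by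
  ext1; funext z
  exact (act_smul A _ _).symm

theorem contDiff_comp_coord {a : ℝ → ℂ} (ha : ContDiff ℝ ∞ a) :
    ContDiff ℝ ∞ (fun z : Plane => a (z 1)) :=
  ha.comp (EuclideanSpace.proj (𝕜 := ℝ) (1 : Fin 2)).contDiff

theorem fderiv_comp_coord {a : ℝ → ℂ} {z : Plane} (ha : DifferentiableAt ℝ a (z 1)) (j : Fin 2) :
    fderiv ℝ (fun w : Plane => a (w 1)) z (EuclideanSpace.single j 1)
      = if j = 1 then deriv a (z 1) else 0 := by
  have h : HasFDerivAt (fun z : Plane => a (z 1)) _ z := HasFDerivAt.comp z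
    (f := fun z : Plane => z 1) (g := a) ha.hasFDerivAt
    (EuclideanSpace.proj (𝕜 := ℝ) (1 : Fin 2)).hasFDerivAt
  rw [h.fderiv]
  fin_cases j <;> simp

/-- Multiplication of test functions by a smooth function of `y`. -/
def coordOp (a : ℝ → ℂ) (ha : ContDiff ℝ ∞ a) : testSpace →ₗ[ℂ] testSpace :=
  mulOp (fun z => a (z 1)) (contDiff_comp_coord ha)

theorem coordOp_apply (a : ℝ → ℂ) (ha : ContDiff ℝ ∞ a) (χ : testSpace) (z : Plane) :
    (coordOp a ha χ).1 z = a (z 1) • χ.1 z := rfl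

theorem coordOp_matOp (a : ℝ → ℂ) (ha : ContDiff ℝ ∞ a) (A : Matrix (Fin 2) (Fin 2) ℂ)
    (χ : testSpace) : coordOp a ha (matOp A χ) = matOp A (coordOp a ha χ) :=
  mulOp_matOp _ _ _ _

theorem contDiff_deriv {a : ℝ → ℂ} (ha : ContDiff ℝ ∞ a) : ContDiff ℝ ∞ (deriv a) := by
  exact ((contDiff_infty_iff_deriv (𝕜 := ℝ)).1 ha).2

theorem derivOp_zero_coordOp (a : ℝ → ℂ) (ha : ContDiff ℝ ∞ a) (χ : testSpace) :
    derivOp 0 (coordOp a ha χ) = coordOp a ha (derivOp 0 χ) := by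
  ext1; funext z
  refine (partialDeriv_smul 0 ((contDiff_comp_coord ha).differentiable (by simp) z)
    (test_differentiable χ z)).trans ?_
  rw [fderiv_comp_coord (ha.differentiable (by simp) _)]
  simp
  rfl

theorem derivOp_one_coordOp (a : ℝ → ℂ) (ha : ContDiff ℝ ∞ a) (χ : testSpace) :
    derivOp 1 (coordOp a ha χ) = coordOp a ha (derivOp 1 χ)
      + coordOp (deriv a) (contDiff_deriv ha) χ := by
  ext1; funext z
  refine (partialDeriv_smul 1 ((contDiff_comp_coord ha).differentiable (by simp) z)
    (test_differentiable χ z)).trans ?_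
  rw [fderiv_comp_coord (ha.differentiable (by simp) _), if_pos rfl]
  rfl

theorem norm_toState_matOp_le (A : Matrix (Fin 2) (Fin 2) ℂ) (χ : testSpace) :
    ‖toState (matOp A χ)‖ ≤ ‖Matrix.toEuclideanCLM (n := Fin 2) (𝕜 := ℂ) A‖ * ‖toState χ‖ :=
  norm_toState_le fun _ => norm_act_le A _

theorem norm_toState_coordOp_le {a : ℝ → ℂ} (ha : ContDiff ℝ ∞ a) {K : ℝ} (hK : ∀ y, ‖a y‖ ≤ K)
    (χ : testSpace) : ‖toState (coordOp a ha χ)‖ ≤ K * ‖toState χ‖ :=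
  norm_toState_le fun _ => by
    rw [coordOp_apply, norm_smul]
    exact mul_le_mul_of_nonneg_right (hK _) (norm_nonneg _)

theorem inner_matOp (A : Matrix (Fin 2) (Fin 2) ℂ) (χ η : testSpace) :
    inner ℂ (toState (matOp A χ)) (toState η) = inner ℂ (toState χ) (toState (matOp Aᴴ η)) := by
  rw [inner_toState_toState, inner_toState_toState]
  exact integral_congr_ae (.of_forall fun z => inner_act A _ _)

theorem inner_coordOp {a : ℝ → ℂ} (ha : ContDiff ℝ ∞ a) (har : ∀ y, star (a y) = a y)
    (χ η : testSpace) :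
    inner ℂ (toState (coordOp a ha χ)) (toState η)
      = inner ℂ (toState χ) (toState (coordOp a ha η)) := by
  rw [inner_toState_toState, inner_toState_toState]
  refine integral_congr_ae (.of_forall fun z => ?_)
  change inner ℂ (a (z 1) • χ.1 z) (η.1 z) = inner ℂ (χ.1 z) (a (z 1) • η.1 z)
  rw [inner_smul_left, inner_smul_right]
  congr 1
  exact har _

/-- The inner product of spinors as a real bilinear map. -/
def innerBilin : Spinor →L[ℝ] Spinor →L[ℝ] ℂ :=
  (isBoundedBilinearMap_inner (𝕜 := ℂ) (E := Spinor)).toContinuousLinearMap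

theorem integrable_inner (χ η : testSpace) : Integrable (fun z => inner ℂ (χ.1 z) (η.1 z)) := by
  refine ((test_continuous χ).inner (test_continuous η)).integrable_of_hasCompactSupport ?_
  refine (test_hasCompactSupport χ).mono' (Function.support_subset_iff'.2 fun z hz => ?_)
  rw [image_eq_zero_of_notMem_tsupport hz, inner_zero_left]

theorem inner_derivOp (j : Fin 2) (χ η : testSpace) :
    inner ℂ (toState (derivOp j χ)) (toState η)
      = -inner ℂ (toState χ) (toState (derivOp j η)) := by
  rw [inner_toState_toState, inner_toState_toState]
  have := integral_bilinear_fderiv_right_eq_neg_left_of_integrable (μ := (volume : Measure Plane))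
    (f := χ.1) (g := η.1) (v := EuclideanSpace.single j 1) (B := innerBilin)
    (integrable_inner (derivOp j χ) η) (integrable_inner χ (derivOp j η)) (integrable_inner χ η)
    (fun z _ => (test_differentiable χ) z) (fun z _ => (test_differentiable η) z)
  exact (neg_eq_iff_eq_neg.2 this).symm

end TestSpace

/-! ### Weak images of states in `H²` under the scalar operators. -/

section WeakImages

theorem HasWeakImage.comp {H T : Type*} [NormedAddCommGroup H] [InnerProductSpace ℂ H]
    [AddCommGroup T] [Module ℂ T] {J : T →ₗ[ℂ] H} {p q : T →ₗ[ℂ] T} {f g h : H}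
    (hp : HasWeakImage J p f g) (hq : HasWeakImage J q g h) : HasWeakImage J (p ∘ₗ q) f h :=
  fun χ => (hp (q χ)).trans (hq χ)

theorem IsWeakPartial.hasWeakImage {j : Fin 2} {f g : State} (h : IsWeakPartial j f g) :
    HasWeakImage toState (derivOp j) f (-g) := by
  intro χ
  rw [inner_toState, inner_neg_right, inner_toState]
  exact h χ χ.2

/-- The strict inequality is what selects an actual family of weak derivatives from the infimum. -/
theorem exists_bounded_of_h2Norm_lt {f : State} {N : ℝ} (h : h2Norm f < ENNReal.ofReal N) :
    ∃ (g : Fin 2 → State) (h : Fin 2 → Fin 2 → State), (∀ j, IsWeakPartial j f (g j)) ∧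
      (∀ j k, IsWeakPartial k (g j) (h j k)) ∧ ‖f‖ ≤ N ∧ (∀ j, ‖g j‖ ≤ N) ∧
      ∀ j k, ‖h j k‖ ≤ N := by
  simp only [h2Norm, iInf_lt_iff] at h
  obtain ⟨g, h, hg, hh, hlt⟩ := h
  have hlt := (ENNReal.ofReal_lt_ofReal_iff_of_nonneg (Real.sqrt_nonneg _)).1 hlt
  have hN : 0 < N := (Real.sqrt_nonneg _).trans_lt hlt
  have hsq := (Real.sqrt_lt' hN).1 hlt
  have a1 : ∀ j, ‖g j‖ ^ 2 ≤ ∑ j, ‖g j‖ ^ 2 := fun j =>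
    Finset.single_le_sum (f := fun j => ‖g j‖ ^ 2) (fun _ _ => sq_nonneg _) (Finset.mem_univ j)
  have a2 : ∀ j k, ‖h j k‖ ^ 2 ≤ ∑ j, ∑ k, ‖h j k‖ ^ 2 := fun j k =>
    (Finset.single_le_sum (f := fun k => ‖h j k‖ ^ 2) (fun _ _ => sq_nonneg _)
      (Finset.mem_univ k)).trans
    (Finset.single_le_sum (f := fun j => ∑ k, ‖h j k‖ ^ 2)
      (fun _ _ => Finset.sum_nonneg fun _ _ => sq_nonneg _) (Finset.mem_univ j))
  have a3 : 0 ≤ ∑ j, ‖g j‖ ^ 2 := Finset.sum_nonneg fun _ _ => sq_nonneg _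
  have a4 : 0 ≤ ∑ j, ∑ k, ‖h j k‖ ^ 2 :=
    Finset.sum_nonneg fun _ _ => Finset.sum_nonneg fun _ _ => sq_nonneg _
  refine ⟨g, h, hg, hh, ?_, fun j => ?_, fun j k => ?_⟩
  · exact le_of_sq_le_sq (by linarith) hN.le
  · exact le_of_sq_le_sq (by linarith [a1 j, sq_nonneg ‖f‖]) hN.le
  · exact le_of_sq_le_sq (by linarith [a2 j k, sq_nonneg ‖f‖]) hN.le

/-- The scalar building blocks `∂_x`, `∂_y` and multiplication by a function of `y`. -/
def blockOp (a : ℝ → ℂ) (ha : ContDiff ℝ ∞ a) : Fin 3 → testSpace →ₗ[ℂ] testSpace :=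
  ![derivOp 0, derivOp 1, coordOp a ha]

theorem blockOp_matOp (a : ℝ → ℂ) (ha : ContDiff ℝ ∞ a) (i : Fin 3)
    (A : Matrix (Fin 2) (Fin 2) ℂ) (χ : testSpace) :
    blockOp a ha i (matOp A χ) = matOp A (blockOp a ha i χ) := by
  fin_cases i
  · exact derivOp_matOp 0 A χ
  · exact derivOp_matOp 1 A χ
  · exact coordOp_matOp a ha A χ

variable {a : ℝ → ℂ} (ha : ContDiff ℝ ∞ a) {K : ℝ} (hK : ∀ y, ‖a y‖ ≤ K)
  (hK' : ∀ y, ‖deriv a y‖ ≤ K) (hK1 : 1 ≤ K)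

include hK hK1 in
theorem exists_weakImage_blockOp {f : State} {N : ℝ} (hf : h2Norm f < ENNReal.ofReal N)
    (i : Fin 3) : ∃ g, ‖g‖ ≤ K * N ∧ HasWeakImage toState (blockOp a ha i) f g := by
  obtain ⟨g, h, hg, hh, hfN, hgN, hhN⟩ := exists_bounded_of_h2Norm_lt hf
  have hN : 0 ≤ N := (norm_nonneg _).trans hfN
  have hd : ∀ j, ∃ k, ‖k‖ ≤ K * N ∧ HasWeakImage toState (derivOp j) f k := fun j =>
    ⟨-g j, by rw [norm_neg]; nlinarith [hgN j], (hg j).hasWeakImage⟩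
  obtain ⟨W, hW, hWn⟩ := exists_weakImage_of_bound denseRange_toState
    (zero_le_one.trans hK1) (norm_toState_coordOp_le ha hK)
  fin_cases i
  · exact hd 0
  · exact hd 1
  · exact ⟨W f, (hWn f).trans (mul_le_mul_of_nonneg_left hfN (zero_le_one.trans hK1)), hW f⟩

-- Weak images compose in the order natural for adjoints, so the delicate case is multiplication by
-- `a` after `∂_y`: it is rewritten as `∂_y (a χ) - a' χ`, since only derivatives of `f` itself are
-- available. This is where the bound on `a'` enters.
include hK hK' hK1 in
theorem exists_weakImage_blockOp_comp {f : State} {N : ℝ} (hf : h2Norm f < ENNReal.ofReal N)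
    (i j : Fin 3) :
    ∃ g, ‖g‖ ≤ 2 * K ^ 2 * N ∧ HasWeakImage toState (blockOp a ha i ∘ₗ blockOp a ha j) f g := by
  obtain ⟨g, h, hg, hh, hfN, hgN, hhN⟩ := exists_bounded_of_h2Norm_lt hf
  have hN : 0 ≤ N := (norm_nonneg _).trans hfN
  have hK0 : 0 ≤ K := zero_le_one.trans hK1
  obtain ⟨W, hW, hWn⟩ := exists_weakImage_of_bound denseRange_toState hK0
    (norm_toState_coordOp_le ha hK)
  obtain ⟨W', hW', hWn'⟩ := exists_weakImage_of_bound denseRange_toState hK0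
    (norm_toState_coordOp_le (contDiff_deriv ha) hK')
  have b0 : K * N ≤ K ^ 2 * N := by nlinarith [mul_nonneg hK0 hN]
  have b1 : N ≤ K * N := by nlinarith
  have b2 : ∀ k, ‖W (g k)‖ ≤ K * N := fun k =>
    (hWn _).trans (mul_le_mul_of_nonneg_left (hgN k) hK0)
  have b3 : ‖W f‖ ≤ K * N := (hWn _).trans (mul_le_mul_of_nonneg_left hfN hK0)
  have b4 : ‖W' f‖ ≤ K * N := (hWn' _).trans (mul_le_mul_of_nonneg_left hfN hK0)
  have b5 : 0 ≤ K ^ 2 * N := by positivity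
  have hdd : ∀ k l, ∃ p, ‖p‖ ≤ 2 * K ^ 2 * N ∧
      HasWeakImage toState (derivOp k ∘ₗ derivOp l) f p := fun k l =>
    ⟨h k l, by linarith [hhN k l], fun χ => by
      rw [LinearMap.comp_apply, (hg k).hasWeakImage, inner_neg_right, (hh k l).hasWeakImage,
        inner_neg_right, neg_neg]⟩
  have hdw : ∀ k, ∃ p, ‖p‖ ≤ 2 * K ^ 2 * N ∧
      HasWeakImage toState (derivOp k ∘ₗ coordOp a ha) f p := fun k =>
    ⟨W (-g k), by rw [map_neg, norm_neg]; linarith [b2 k], (hg k).hasWeakImage.comp (hW _)⟩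
  have hwd0 : HasWeakImage toState (coordOp a ha ∘ₗ derivOp 0) f (W (-g 0)) := fun χ => by
    rw [LinearMap.comp_apply, ← derivOp_zero_coordOp, (hg 0).hasWeakImage, hW]
  have hwd1 : HasWeakImage toState (coordOp a ha ∘ₗ derivOp 1) f (W (-g 1) - W' f) := fun χ => by
    rw [LinearMap.comp_apply, eq_sub_of_add_eq (derivOp_one_coordOp a ha χ).symm, map_sub,
      inner_sub_left, (hg 1).hasWeakImage, hW, hW', inner_sub_right]
  fin_cases i <;> fin_cases j
  · exact hdd 0 0
  · exact hdd 0 1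
  · exact hdw 0
  · exact hdd 1 0
  · exact hdd 1 1
  · exact hdw 1
  · exact ⟨_, by rw [map_neg, norm_neg]; linarith [b2 0], hwd0⟩
  · refine ⟨_, (norm_sub_le _ _).trans ?_, hwd1⟩
    rw [map_neg, norm_neg]
    linarith [b2 1]
  · refine ⟨W (W f), (hWn _).trans ?_, (hW f).comp (hW _)⟩
    nlinarith

theorem exists_weakImage_matOp (A : Matrix (Fin 2) (Fin 2) ℂ) (f : State) :
    ∃ g, ‖g‖ ≤ ‖Matrix.toEuclideanCLM (n := Fin 2) (𝕜 := ℂ) A‖ * ‖f‖ ∧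
      HasWeakImage toState (matOp A) f g := by
  obtain ⟨B, hB, hBn⟩ := exists_weakImage_of_bound denseRange_toState (norm_nonneg _)
    (norm_toState_matOp_le A)
  exact ⟨B f, hBn f, hB f⟩

end WeakImages

/-! ### The five symmetric components of the Dirac operators. -/

section Components

/-- The matrices of the five components of the Dirac operators. -/
def componentMatrix : Fin 5 → Matrix (Fin 2) (Fin 2) ℂ :=
  ![-Complex.I • pauli1, -Complex.I • pauli2, -Complex.I • pauli3, pauli2, pauli3]

/-- The scalar blocks of the five components of the Dirac operators. -/
def componentBlock : Fin 5 → Fin 3 := ![0, 1, 1, 2, 2]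

/-- The operators `(1/i) ∂_x σ₁`, `(1/i) ∂_y σ₂`, `(1/i) ∂_y σ₃`, `a(y) σ₂`, `a(y) σ₃`. -/
def component (a : ℝ → ℂ) (ha : ContDiff ℝ ∞ a) (k : Fin 5) : testSpace →ₗ[ℂ] testSpace :=
  blockOp a ha (componentBlock k) ∘ₗ matOp (componentMatrix k)

theorem pauli1_conjTranspose : pauli1ᴴ = pauli1 := by
  ext i j; fin_cases i <;> fin_cases j <;> simp [pauli1]

theorem pauli2_conjTranspose : pauli2ᴴ = pauli2 := by
  ext i j; fin_cases i <;> fin_cases j <;> simp [pauli2]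

theorem pauli3_conjTranspose : pauli3ᴴ = pauli3 := by
  ext i j; fin_cases i <;> fin_cases j <;> simp [pauli3]

theorem inner_component {a : ℝ → ℂ} (ha : ContDiff ℝ ∞ a) (har : ∀ y, star (a y) = a y)
    (k : Fin 5) (χ η : testSpace) :
    inner ℂ (toState (component a ha k χ)) (toState η)
      = inner ℂ (toState χ) (toState (component a ha k η)) := by
  have h1 : ∀ j (A : Matrix (Fin 2) (Fin 2) ℂ), Aᴴ = A →
      inner ℂ (toState (derivOp j (matOp (-Complex.I • A) χ))) (toState η)
        = inner ℂ (toState χ) (toState (derivOp j (matOp (-Complex.I • A) η))) := by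
    intro j A hA
    rw [inner_derivOp, inner_matOp, derivOp_matOp, Matrix.conjTranspose_smul, hA]
    rw [matOp_smul, matOp_smul]
    simp
  have h2 : ∀ (A : Matrix (Fin 2) (Fin 2) ℂ), Aᴴ = A →
      inner ℂ (toState (coordOp a ha (matOp A χ))) (toState η)
        = inner ℂ (toState χ) (toState (coordOp a ha (matOp A η))) := by
    intro A hA
    rw [inner_coordOp ha har, inner_matOp, coordOp_matOp, hA]
  fin_cases k
  · exact h1 0 _ pauli1_conjTranspose
  · exact h1 1 _ pauli2_conjTranspose
  · exact h1 1 _ pauli3_conjTranspose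
  · exact h2 _ pauli2_conjTranspose
  · exact h2 _ pauli3_conjTranspose

/-- Constant matrices commute with the scalar blocks, so a product of two components is a product of
two blocks after a single matrix, and the scalar bounds apply. -/
theorem exists_weakImage_component {a : ℝ → ℂ} (ha : ContDiff ℝ ∞ a) {K : ℝ}
    (hK : ∀ y, ‖a y‖ ≤ K) (hK' : ∀ y, ‖deriv a y‖ ≤ K) (hK1 : 1 ≤ K) :
    ∃ C, 0 ≤ C ∧ ∀ (f : State) (N : ℝ), h2Norm f < ENNReal.ofReal N →
      (∀ k, ∃ g, ‖g‖ ≤ C * N ∧ HasWeakImage toState (component a ha k) f g) ∧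
      ∀ k l, ∃ g, ‖g‖ ≤ C * N ∧
        HasWeakImage toState (component a ha k ∘ₗ component a ha l) f g := by
  set nA : Matrix (Fin 2) (Fin 2) ℂ → ℝ :=
    fun A => ‖Matrix.toEuclideanCLM (n := Fin 2) (𝕜 := ℂ) A‖
  set S : ℝ := ∑ k, nA (componentMatrix k)
    + ∑ k, ∑ l, nA (componentMatrix k * componentMatrix l)
  have n0 : ∀ A, 0 ≤ nA A := fun A => norm_nonneg _
  have s1 : 0 ≤ ∑ k, nA (componentMatrix k) := Finset.sum_nonneg fun _ _ => n0 _
  have s2 : 0 ≤ ∑ k, ∑ l, nA (componentMatrix k * componentMatrix l) :=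
    Finset.sum_nonneg fun _ _ => Finset.sum_nonneg fun _ _ => n0 _
  have hS : 0 ≤ S := add_nonneg s1 s2
  have hS1 : ∀ k, nA (componentMatrix k) ≤ S := fun k =>
    (Finset.single_le_sum (f := fun k => nA (componentMatrix k)) (fun _ _ => n0 _)
      (Finset.mem_univ k)).trans (le_add_of_nonneg_right s2)
  have hS2 : ∀ k l, nA (componentMatrix k * componentMatrix l) ≤ S := fun k l =>
    ((Finset.single_le_sum (f := fun l => nA (componentMatrix k * componentMatrix l))
      (fun _ _ => n0 _) (Finset.mem_univ l)).trans
    (Finset.single_le_sum (f := fun k => ∑ l, nA (componentMatrix k * componentMatrix l))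
      (fun _ _ => Finset.sum_nonneg fun _ _ => n0 _) (Finset.mem_univ k))).trans
    (le_add_of_nonneg_left s1)
  clear_value S
  refine ⟨S * (2 * K ^ 2), mul_nonneg hS (by positivity), fun f N hf => ⟨fun k => ?_, fun k l => ?_⟩⟩
  · obtain ⟨g, hgN, hg⟩ := exists_weakImage_blockOp ha hK hK1 hf (componentBlock k)
    obtain ⟨h, hhN, hh⟩ := exists_weakImage_matOp (componentMatrix k) g
    refine ⟨h, hhN.trans ?_, hg.comp hh⟩
    have hN : 0 ≤ K * N := (norm_nonneg _).trans hgN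
    rw [mul_assoc]
    refine mul_le_mul (hS1 k) (hgN.trans ?_) (norm_nonneg _) hS
    nlinarith
  · obtain ⟨g, hgN, hg⟩ := exists_weakImage_blockOp_comp ha hK hK' hK1 hf
      (componentBlock k) (componentBlock l)
    obtain ⟨h, hhN, hh⟩ := exists_weakImage_matOp (componentMatrix k * componentMatrix l) g
    refine ⟨h, hhN.trans ?_, ?_⟩
    · rw [mul_assoc]
      exact mul_le_mul (hS2 k l) hgN (norm_nonneg _) hS
    · have : component a ha k ∘ₗ component a ha l
          = (blockOp a ha (componentBlock k) ∘ₗ blockOp a ha (componentBlock l))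
            ∘ₗ matOp (componentMatrix k * componentMatrix l) := by
        ext1 χ
        simp only [component, LinearMap.comp_apply]
        rw [← matOp_matOp, blockOp_matOp a ha (componentBlock l) (componentMatrix k)]
      rw [this]
      exact hg.comp hh

end Components

/-! ### Translations in `L²`. -/

section Translation

/-- Translation of test functions. -/
def transOp (h : Plane) : testSpace →ₗ[ℂ] testSpace where
  toFun χ := ⟨fun z => χ.1 (z - h),
    ⟨(test_contDiff χ).comp (contDiff_id.sub contDiff_const),
      (test_hasCompactSupport χ).comp_homeomorph (Homeomorph.subRight h)⟩⟩
  map_add' _ _ := rfl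
  map_smul' _ _ := rfl

theorem transOp_apply (h : Plane) (χ : testSpace) (z : Plane) :
    (transOp h χ).1 z = χ.1 (z - h) := rfl

theorem inner_transOp (h : Plane) (χ η : testSpace) :
    inner ℂ (toState (transOp h χ)) (toState η)
      = inner ℂ (toState χ) (toState (transOp (-h) η)) := by
  rw [inner_toState_toState, inner_toState_toState]
  have := integral_sub_right_eq_self (μ := (volume : Measure Plane))
    (fun z => inner ℂ (χ.1 z) (η.1 (z + h))) h
  simp only [sub_add_cancel] at this
  refine this.trans (integral_congr_ae (.of_forall fun z => ?_))
  simp only [transOp_apply, sub_neg_eq_add]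

theorem norm_toState_transOp (h : Plane) (χ : testSpace) :
    ‖toState (transOp h χ)‖ = ‖toState χ‖ := by
  have h1 : inner ℂ (toState (transOp h χ)) (toState (transOp h χ))
      = inner ℂ (toState χ) (toState χ) := by
    rw [inner_transOp]
    congr 2
    ext1; funext z
    simp [transOp_apply]
  rw [inner_self_eq_norm_sq_to_K, inner_self_eq_norm_sq_to_K] at h1
  have h2 : ‖toState (transOp h χ)‖ ^ 2 = ‖toState χ‖ ^ 2 := by exact_mod_cast h1
  exact (sq_eq_sq₀ (norm_nonneg _) (norm_nonneg _)).1 h2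

/-- A test function is Lipschitz, and for shifts shorter than `1` the difference lives in a fixed
compact set of finite measure. -/
theorem exists_norm_transOp_sub_le (χ : testSpace) {δ : ℝ} (hδ : 0 < δ) :
    ∃ r > 0, ∀ h : Plane, ‖h‖ < r → ‖toState (transOp h χ - χ)‖ ≤ δ := by
  obtain ⟨L, hL⟩ := (test_contDiff χ).lipschitzWith_of_hasCompactSupport
    (test_hasCompactSupport χ) (by simp)
  set S : Set Plane := Metric.cthickening 1 (tsupport χ.1)
  have hS : IsCompact S := (test_hasCompactSupport χ).isCompact.cthickening
  set M : ℝ := (volume S ^ (1 / (2 : ℝ≥0∞).toReal)).toReal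
  have hM : volume S ^ (1 / (2 : ℝ≥0∞).toReal) ≠ ⊤ := by
    refine ENNReal.rpow_ne_top_of_nonneg (by positivity) hS.measure_lt_top.ne
  have hM0 : 0 ≤ M := ENNReal.toReal_nonneg
  refine ⟨min 1 (δ / ((L + 1) * (M + 1))), by positivity, fun h hh => ?_⟩
  have hh1 : ‖h‖ < 1 := hh.trans_le (min_le_left _ _)
  have hh2 : ‖h‖ < δ / ((L + 1) * (M + 1)) := hh.trans_le (min_le_right _ _)
  have hsub : tsupport χ.1 ⊆ S := Metric.self_subset_cthickening _
  have key := eLpNorm_sub_le_of_dist_bdd (volume : Measure Plane) (p := 2) (by simp)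
    hS.measurableSet (c := L * ‖h‖) (f := (transOp h χ).1) (g := χ.1) (by positivity)
    (fun z => by
      rw [transOp_apply]
      refine (hL.dist_le_mul _ _).trans (le_of_eq ?_)
      rw [dist_eq_norm, sub_sub_cancel_left, norm_neg])
    (fun z hz => by
      refine Metric.mem_cthickening_of_dist_le z (z - h) 1 _
        (subset_tsupport _ (Function.mem_support.2 hz)) ?_
      rw [dist_eq_norm, sub_sub_cancel]
      exact hh1.le)
    (fun z hz => hsub (subset_tsupport _ hz))
  have hnorm : ‖toState (transOp h χ - χ)‖
      = (eLpNorm ((transOp h χ).1 - χ.1) 2 volume).toReal :=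
    Lp.norm_toLp _ (test_memLp (transOp h χ - χ))
  rw [hnorm]
  refine (ENNReal.toReal_mono (ENNReal.mul_ne_top ENNReal.ofReal_ne_top hM) key).trans ?_
  rw [ENNReal.toReal_mul, ENNReal.toReal_ofReal (by positivity)]
  rw [lt_div_iff₀ (by positivity)] at hh2
  have hL0 : (0 : ℝ) ≤ L := L.2
  change L * ‖h‖ * M ≤ δ
  have := norm_nonneg h
  nlinarith [mul_nonneg this hL0, mul_nonneg this hM0]

end Translation

/-! ### Averages over translations: convolution and its commutators. -/

section Averages

/-- Fubini for the pairing. The average is given pointwise, so no vector-valued integral in `L²` is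
needed. -/
theorem inner_toState_integral {κ : Plane → ℝ} (hκ : Continuous κ) (hκ' : HasCompactSupport κ)
    {ξ : testSpace} {F : Plane → testSpace}
    (hF : Continuous fun p : Plane × Plane => (F p.2).1 p.1)
    (hξ : ∀ z, ξ.1 z = ∫ h, κ h • (F h).1 z) (η : testSpace) :
    inner ℂ (toState η) (toState ξ)
      = ∫ h, κ h • inner ℂ (toState η) (toState (F h)) := by
  have hint : ∀ z, Integrable fun h => κ h • (F h).1 z := fun z =>
    (hκ.smul (hF.comp (by fun_prop : Continuous fun h : Plane =>
      (z, h)))).integrable_of_hasCompactSupport hκ'.smul_right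
  have h1 : inner ℂ (toState η) (toState ξ)
      = ∫ z, ∫ h, κ h • inner ℂ (η.1 z) ((F h).1 z) := by
    rw [inner_toState_toState]
    refine integral_congr_ae (.of_forall fun z => ?_)
    change inner ℂ (η.1 z) (ξ.1 z) = _
    rw [hξ, ← integral_inner (hint z)]
    simp only [inner_smul_right_eq_smul]
  rw [h1, integral_integral_swap_of_hasCompactSupport]
  · refine integral_congr_ae (.of_forall fun h => ?_)
    change ∫ z, κ h • inner ℂ (η.1 z) ((F h).1 z) = _
    rw [integral_smul]
    exact congrArg (κ h • ·) (inner_toState_toState η (F h)).symm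
  · exact (hκ.comp continuous_snd).smul (((test_continuous η).comp continuous_fst).inner hF)
  · refine HasCompactSupport.intro ((test_hasCompactSupport η).isCompact.prod hκ'.isCompact) ?_
    rintro ⟨z, h⟩ hzh
    rw [Set.mem_prod, not_and_or] at hzh
    rcases hzh with hz | hh
    · simp [Function.uncurry, image_eq_zero_of_notMem_tsupport hz]
    · simp [Function.uncurry, image_eq_zero_of_notMem_tsupport hh]

/-- Minkowski's integral inequality by duality, with `ξ` paired with itself. The bound on `F h` is
required only where `κ` does not vanish, so that the small support of a mollifier can be exploited.
-/
theorem norm_toState_integral_le {κ : Plane → ℝ} (hκ : Continuous κ) (hκ' : HasCompactSupport κ)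
    {ξ : testSpace} {F : Plane → testSpace}
    (hF : Continuous fun p : Plane × Plane => (F p.2).1 p.1)
    (hξ : ∀ z, ξ.1 z = ∫ h, κ h • (F h).1 z) {C : ℝ}
    (hC : ∀ h, κ h ≠ 0 → ‖toState (F h)‖ ≤ C) :
    ‖toState ξ‖ ≤ (∫ h, |κ h|) * C := by
  have h1 := inner_toState_integral hκ hκ' hF hξ ξ
  have h2 : ‖inner ℂ (toState ξ) (toState ξ)‖ ≤ ∫ h, |κ h| * (‖toState ξ‖ * C) := by
    rw [h1]
    refine norm_integral_le_of_norm_le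
      ((hκ.integrable_of_hasCompactSupport hκ').abs.mul_const _) (.of_forall fun h => ?_)
    rw [norm_smul, Real.norm_eq_abs]
    by_cases hh : κ h = 0
    · simp [hh]
    · exact mul_le_mul_of_nonneg_left ((norm_inner_le_norm _ _).trans
        (mul_le_mul_of_nonneg_left (hC h hh) (norm_nonneg _))) (abs_nonneg _)
  rw [integral_mul_const, inner_self_eq_norm_sq_to_K] at h2
  simp only [norm_pow, RCLike.norm_ofReal, abs_norm] at h2
  rcases (norm_nonneg (toState ξ)).eq_or_lt with h0 | h0
  · rw [← h0]
    -- The hypothesis forces `0 ≤ C` only when `κ` is nonzero somewhere; otherwise the integral is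
    -- zero.
    by_cases hex : ∃ h, κ h ≠ 0
    · obtain ⟨h, hh⟩ := hex
      exact mul_nonneg (integral_nonneg fun _ => abs_nonneg _)
        ((norm_nonneg _).trans (hC h hh))
    · push Not at hex
      simp [hex]
  · nlinarith

/-- Convolution of test functions with a smooth compactly supported kernel. -/
def convOp (κ : Plane → ℝ) (hκ : ContDiff ℝ ∞ κ) (hκ' : HasCompactSupport κ) :
    testSpace →ₗ[ℂ] testSpace where
  toFun χ := ⟨convolution κ χ.1 (ContinuousLinearMap.lsmul ℝ ℝ) volume,
    ⟨(test_hasCompactSupport χ).contDiff_convolution_right _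
      hκ.continuous.locallyIntegrable (test_contDiff χ),
      hκ'.convolution _ (test_hasCompactSupport χ)⟩⟩
  map_add' χ η := by
    ext1
    exact ((test_hasCompactSupport χ).convolutionExists_right _ hκ.continuous.locallyIntegrable
      (test_continuous χ)).distrib_add ((test_hasCompactSupport η).convolutionExists_right _
      hκ.continuous.locallyIntegrable (test_continuous η))
  map_smul' c χ := by
    ext1; funext z
    change ∫ h, κ h • (c • χ.1 (z - h)) = c • ∫ h, κ h • χ.1 (z - h)
    rw [← integral_smul]
    simp only [smul_comm c]

variable {κ : Plane → ℝ} (hκ : ContDiff ℝ ∞ κ) (hκ' : HasCompactSupport κ)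

theorem convOp_apply (χ : testSpace) (z : Plane) :
    (convOp κ hκ hκ' χ).1 z = ∫ h, κ h • χ.1 (z - h) := rfl

theorem continuous_transOp (χ : testSpace) :
    Continuous fun p : Plane × Plane => (transOp p.2 χ).1 p.1 :=
  (test_continuous χ).comp (continuous_fst.sub continuous_snd)

include hκ hκ' in
theorem integrable_convOp (χ : testSpace) (z : Plane) :
    Integrable fun h => κ h • χ.1 (z - h) :=
  (hκ.continuous.smul ((test_continuous χ).comp
    (continuous_const.sub continuous_id))).integrable_of_hasCompactSupport hκ'.smul_right

theorem norm_toState_convOp_le (χ : testSpace) :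
    ‖toState (convOp κ hκ hκ' χ)‖ ≤ (∫ h, |κ h|) * ‖toState χ‖ :=
  norm_toState_integral_le hκ.continuous hκ' (F := fun h => transOp h χ) (continuous_transOp χ)
    (convOp_apply hκ hκ' χ)
    fun h _ => (norm_toState_transOp h χ).le

theorem inner_convOp (heven : ∀ h, κ (-h) = κ h) (χ η : testSpace) :
    inner ℂ (toState (convOp κ hκ hκ' χ)) (toState η)
      = inner ℂ (toState χ) (toState (convOp κ hκ hκ' η)) := by
  rw [← inner_conj_symm, inner_toState_integral hκ.continuous hκ'
    (F := fun h => transOp h χ) (continuous_transOp χ) (convOp_apply hκ hκ' χ),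
    inner_toState_integral hκ.continuous hκ' (F := fun h => transOp h η) (continuous_transOp η)
    (convOp_apply hκ hκ' η), ← integral_conj, ← integral_neg_eq_self]
  refine integral_congr_ae (.of_forall fun h => ?_)
  simp only
  rw [heven, Complex.real_smul, Complex.real_smul, map_mul, Complex.conj_ofReal, inner_conj_symm,
    inner_transOp, neg_neg]

theorem convOp_matOp (A : Matrix (Fin 2) (Fin 2) ℂ) (χ : testSpace) :
    convOp κ hκ hκ' (matOp A χ) = matOp A (convOp κ hκ hκ' χ) := by
  ext1; funext z
  have := ((Matrix.toEuclideanCLM (n := Fin 2) (𝕜 := ℂ) A).restrictScalars ℝ).integral_comp_comm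
    (integrable_convOp hκ hκ' χ z)
  refine Eq.trans ?_ this
  rw [convOp_apply]
  refine integral_congr_ae (.of_forall fun h => ?_)
  exact (map_smul ((Matrix.toEuclideanCLM (n := Fin 2) (𝕜 := ℂ) A).restrictScalars ℝ) _ _).symm

theorem derivOp_convOp (j : Fin 2) (χ : testSpace) :
    derivOp j (convOp κ hκ hκ' χ) = convOp κ hκ hκ' (derivOp j χ) := by
  ext1; funext z
  have h := (test_hasCompactSupport χ).hasFDerivAt_convolution_right
    (ContinuousLinearMap.lsmul ℝ ℝ) (hκ.continuous.locallyIntegrable (μ := volume))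
    ((test_contDiff χ).of_le (by simp)) z
  change fderiv ℝ (convolution κ χ.1 (ContinuousLinearMap.lsmul ℝ ℝ) volume) z _ = _
  rw [h.fderiv]
  exact convolution_precompR_apply _ hκ.continuous.locallyIntegrable
    ((test_hasCompactSupport χ).fderiv (𝕜 := ℝ))
    ((test_contDiff χ).continuous_fderiv (by simp)) z _

/-- The derivative falls on the kernel, leaving a convolution with `∂_j κ`. -/
theorem exists_norm_derivOp_convOp_le (j : Fin 2) :
    ∃ C, 0 ≤ C ∧ ∀ χ, ‖toState (derivOp j (convOp κ hκ hκ' χ))‖ ≤ C * ‖toState χ‖ := by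
  have hκj : ContDiff ℝ ∞ fun z => fderiv ℝ κ z (EuclideanSpace.single j 1) :=
    (hκ.fderiv_right (m := ∞) (by simp)).clm_apply contDiff_const
  have hκj' : HasCompactSupport fun z => fderiv ℝ κ z (EuclideanSpace.single j 1) :=
    hκ'.fderiv_apply (𝕜 := ℝ) _
  refine ⟨∫ z, |fderiv ℝ κ z (EuclideanSpace.single j 1)|,
    integral_nonneg fun _ => abs_nonneg _, fun χ => ?_⟩
  convert norm_toState_convOp_le hκj hκj' χ using 3
  ext1; funext z
  have h := hκ'.hasFDerivAt_convolution_left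
    (ContinuousLinearMap.lsmul ℝ ℝ) (hκ.of_le (by simp))
    ((test_continuous χ).locallyIntegrable (μ := volume)) z
  change fderiv ℝ (convolution κ χ.1 (ContinuousLinearMap.lsmul ℝ ℝ) volume) z _ = _
  rw [h.fderiv, convolution_def, ContinuousLinearMap.integral_apply]
  · rfl
  · exact ((hκ'.fderiv (𝕜 := ℝ)).convolutionExists_left _
      (hκ.continuous_fderiv (by simp)) (test_continuous χ).locallyIntegrable z)

/-- The commutator is the average over `h` of translates multiplied by `a(y) - a(y - h₁)`, with `h₁`
the second coordinate of `h`. The mean value inequality makes this factor at most `K r` on the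
support of the kernel. -/
theorem norm_coordOp_convOp_sub_le {a : ℝ → ℂ} (ha : ContDiff ℝ ∞ a) {K r : ℝ}
    (hK' : ∀ y, ‖deriv a y‖ ≤ K) (hsupp : ∀ h, κ h ≠ 0 → ‖h‖ ≤ r) (χ : testSpace) :
    ‖toState (coordOp a ha (convOp κ hκ hκ' χ)) - toState (convOp κ hκ hκ' (coordOp a ha χ))‖
      ≤ (∫ h, |κ h|) * (K * r * ‖toState χ‖) := by
  have hK : 0 ≤ K := (norm_nonneg _).trans (hK' 0)
  rw [← map_sub]
  refine norm_toState_integral_le hκ.continuous hκ'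
    (F := fun h => coordOp a ha (transOp h χ) - transOp h (coordOp a ha χ)) ?_ (fun z => ?_)
    fun h hh => ?_
  · exact ((contDiff_comp_coord ha).continuous.comp continuous_fst).smul (continuous_transOp χ)
      |>.sub (continuous_transOp (coordOp a ha χ))
  · change a (z 1) • (∫ h, κ h • χ.1 (z - h)) - ∫ h, κ h • (coordOp a ha χ).1 (z - h)
      = ∫ h, κ h • (a (z 1) • χ.1 (z - h) - (coordOp a ha χ).1 (z - h))
    rw [← integral_smul]
    refine (integral_sub ((integrable_convOp hκ hκ' χ z).smul (a (z 1)))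
      (integrable_convOp hκ hκ' _ z)).symm.trans ?_
    refine integral_congr_ae (.of_forall fun h => ?_)
    simp only [smul_sub]
    rw [smul_comm]
    rfl
  · rw [← norm_toState_transOp h χ]
    refine norm_toState_le fun z => ?_
    change ‖a (z 1) • χ.1 (z - h) - a ((z - h) 1) • χ.1 (z - h)‖ ≤ K * r * ‖χ.1 (z - h)‖
    rw [← sub_smul, norm_smul]
    refine mul_le_mul_of_nonneg_right ?_ (norm_nonneg _)
    have h1 := convex_univ.norm_image_sub_le_of_norm_deriv_le (f := a) (C := K)
      (fun y _ => ha.differentiable (by simp) y) (fun y _ => hK' y)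
      (mem_univ ((z - h) 1)) (mem_univ (z 1))
    refine h1.trans (mul_le_mul_of_nonneg_left ?_ hK)
    have h2 : z 1 - (z - h) 1 = h 1 := by simp
    rw [h2]
    exact (PiLp.norm_apply_le h 1).trans (hsupp h hh)

end Averages

/-- Friedrichs mollification with an even bump of mass one. Evenness gives symmetry and unit mass
gives contraction. Constant matrices and derivatives commute with it exactly, so only multiplication
by `a` contributes a commutator. -/
theorem exists_regularizer {a : ℝ → ℂ} (ha : ContDiff ℝ ∞ a) {K : ℝ}
    (hK : ∀ y, ‖a y‖ ≤ K) (hK' : ∀ y, ‖deriv a y‖ ≤ K) {δ : ℝ} (hδ : 0 < δ) (χ₀ : testSpace) :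
    ∃ σ, IsRegularizer toState (component a ha) δ σ ∧ ‖toState (σ χ₀) - toState χ₀‖ ≤ δ := by
  have hK0 : 0 ≤ K := (norm_nonneg _).trans (hK 0)
  obtain ⟨n, hn0, hn⟩ : ∃ n : ℝ, 0 ≤ n ∧ ∀ k χ,
      ‖toState (matOp (componentMatrix k) χ)‖ ≤ n * ‖toState χ‖ := by
    refine ⟨∑ k, ‖Matrix.toEuclideanCLM (n := Fin 2) (𝕜 := ℂ) (componentMatrix k)‖,
      Finset.sum_nonneg fun _ _ => norm_nonneg _, fun k χ =>
        (norm_toState_matOp_le _ χ).trans (mul_le_mul_of_nonneg_right ?_ (norm_nonneg _))⟩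
    exact Finset.single_le_sum
      (f := fun k => ‖Matrix.toEuclideanCLM (n := Fin 2) (𝕜 := ℂ) (componentMatrix k)‖)
      (fun _ _ => norm_nonneg _) (Finset.mem_univ k)
  obtain ⟨r₁, hr₁, htrans⟩ := exists_norm_transOp_sub_le χ₀ hδ
  -- The first bound brings `σ χ₀` within `δ` of `χ₀`; the second makes the commutator bound `K * r
  -- * n` at most `δ`. The shifts by `1` keep the denominator positive.
  set r := min r₁ (δ / ((K + 1) * (n + 1)))
  have hr : 0 < r := by positivity
  have hrδ : K * r * n ≤ δ := by
    have h1 : r ≤ δ / ((K + 1) * (n + 1)) := min_le_right _ _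
    rw [le_div_iff₀ (by positivity)] at h1
    nlinarith [mul_nonneg hr.le hK0, mul_nonneg hr.le hn0]
  let b : ContDiffBump (0 : Plane) := ⟨r / 2, r, by positivity, by linarith⟩
  set ρ : Plane → ℝ := b.normed volume with hρdef
  have hρ : ContDiff ℝ ∞ ρ := b.contDiff_normed
  have hρ' : HasCompactSupport ρ := b.hasCompactSupport_normed
  have hsupp : ∀ h, ρ h ≠ 0 → ‖h‖ < r := by
    intro h hh
    have : h ∈ Function.support ρ := hh
    rw [hρdef, b.support_normed_eq] at this
    simpa using this
  have hint : ∫ h, |ρ h| = 1 := by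
    rw [← b.integral_normed (μ := volume)]
    exact integral_congr_ae (.of_forall fun h => abs_of_nonneg (b.nonneg_normed h))
  refine ⟨convOp ρ hρ hρ', ⟨fun χ η => ?_, fun χ => ?_, fun k => ?_, fun k χ => ?_⟩, ?_⟩
  · exact inner_convOp hρ hρ' (fun h => b.normed_neg h) χ η
  · simpa [hint] using norm_toState_convOp_le hρ hρ' χ
  · have hblock : ∀ i, ∃ C, 0 ≤ C ∧ ∀ χ,
        ‖toState (blockOp a ha i (convOp ρ hρ hρ' χ))‖ ≤ C * ‖toState χ‖ := by
      intro i
      fin_cases i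
      · exact exists_norm_derivOp_convOp_le hρ hρ' 0
      · exact exists_norm_derivOp_convOp_le hρ hρ' 1
      · refine ⟨K, hK0, fun χ => (norm_toState_coordOp_le ha hK _).trans
          (mul_le_mul_of_nonneg_left ?_ hK0)⟩
        simpa [hint] using norm_toState_convOp_le hρ hρ' χ
    obtain ⟨C, hC0, hC⟩ := hblock (componentBlock k)
    refine ⟨C * n, mul_nonneg hC0 hn0, fun χ => ?_⟩
    rw [component, LinearMap.comp_apply, ← convOp_matOp, mul_assoc]
    exact (hC _).trans (mul_le_mul_of_nonneg_left (hn k χ) hC0)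
  · have hblock : ∀ i χ, ‖toState (blockOp a ha i (convOp ρ hρ hρ' χ))
        - toState (convOp ρ hρ hρ' (blockOp a ha i χ))‖ ≤ K * r * ‖toState χ‖ := by
      have hd : ∀ j χ, ‖toState (derivOp j (convOp ρ hρ hρ' χ))
          - toState (convOp ρ hρ hρ' (derivOp j χ))‖ ≤ K * r * ‖toState χ‖ := by
        intro j χ
        rw [derivOp_convOp, sub_self, norm_zero]
        positivity
      intro i χ
      fin_cases i
      · exact hd 0 χ
      · exact hd 1 χ
      · have := norm_coordOp_convOp_sub_le hρ hρ' ha hK' (fun h hh => (hsupp h hh).le) χ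
        rwa [hint, one_mul] at this
    have h1 := hblock (componentBlock k) (matOp (componentMatrix k) χ)
    rw [component, LinearMap.comp_apply, LinearMap.comp_apply, ← convOp_matOp]
    refine h1.trans ((mul_le_mul_of_nonneg_left (hn k χ) (by positivity)).trans ?_)
    rw [← mul_assoc]
    exact mul_le_mul_of_nonneg_right hrδ (norm_nonneg _)
  · rw [← map_sub]
    have := norm_toState_integral_le (ξ := convOp ρ hρ hρ' χ₀ - χ₀) (C := δ) hρ.continuous hρ'
      (F := fun h => transOp h χ₀ - χ₀)
      ((continuous_transOp χ₀).sub ((test_continuous χ₀).comp continuous_fst)) (fun z => ?_)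
      fun h hh => htrans h ((hsupp h hh).trans_le (min_le_left _ _))
    · rwa [hint, one_mul] at this
    · change (∫ h, ρ h • χ₀.1 (z - h)) - χ₀.1 z = ∫ h, ρ h • (χ₀.1 (z - h) - χ₀.1 z)
      simp only [smul_sub]
      rw [integral_sub (integrable_convOp hρ hρ' χ₀ z)
        ((hρ.continuous.integrable_of_hasCompactSupport hρ').smul_const _), integral_smul_const,
        b.integral_normed, one_smul]

/-! ### Periodic antiderivatives and the time-dependent coefficients. -/

section Averaging

theorem antideriv_zero (f : ℝ → ℝ) : antideriv f 0 = 0 := by simp [antideriv]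

theorem hasDerivAt_antideriv {f : ℝ → ℝ} (hf : Continuous f) (τ : ℝ) :
    HasDerivAt (antideriv f) (f τ) τ :=
  hf.integral_hasStrictDerivAt 0 τ |>.hasDerivAt

theorem continuous_antideriv {f : ℝ → ℝ} (hf : Continuous f) : Continuous (antideriv f) :=
  continuous_iff_continuousAt.2 fun τ => (hasDerivAt_antideriv hf τ).continuousAt

theorem periodic_antideriv {f : ℝ → ℝ} {t₀ : ℝ} (hf : Continuous f)
    (hper : Function.Periodic f t₀) (hmean : (∫ τ in (0 : ℝ)..t₀, f τ) = 0) :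
    Function.Periodic (antideriv f) t₀ := by
  intro τ
  have h1 := hper.intervalIntegral_add_eq τ 0
  rw [zero_add, hmean] at h1
  rw [antideriv, ← intervalIntegral.integral_add_adjacent_intervals
    (hf.intervalIntegrable 0 τ) (hf.intervalIntegrable τ (τ + t₀)), h1, add_zero]
  rfl

theorem exists_bound_of_periodic {f : ℝ → ℝ} {t₀ : ℝ} (ht₀ : 0 < t₀) (hf : Continuous f)
    (hper : Function.Periodic f t₀) : ∃ C, ∀ τ, |f τ| ≤ C := by
  obtain ⟨C, hC⟩ := (isCompact_Icc (a := (0 : ℝ)) (b := t₀)).exists_bound_of_continuousOn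
    hf.continuousOn
  refine ⟨C, fun τ => ?_⟩
  obtain ⟨s, hs, hsτ⟩ := hper.exists_mem_Ico₀ ht₀ τ
  rw [hsτ]
  exact hC s ⟨hs.1, hs.2.le⟩

theorem integral_sub_timeAverage {f : ℝ → ℝ} {t₀ : ℝ} (ht₀ : 0 < t₀) (hf : Continuous f) :
    (∫ τ in (0 : ℝ)..t₀, (f τ - timeAverage t₀ f)) = 0 := by
  rw [intervalIntegral.integral_sub (hf.intervalIntegrable 0 t₀) intervalIntegrable_const,
    intervalIntegral.integral_const, timeAverage, sub_zero, smul_eq_mul, ← mul_assoc,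
    mul_one_div_cancel ht₀.ne', one_mul, sub_self]

/-- The coefficients of `U₋₁(τ)* (D · σ) U₋₁(τ)` with respect to the five components. -/
def conjCoeff (f₀ f₁ : ℝ → ℝ) (τ : ℝ) : Fin 5 → ℝ :=
  ![1, Real.cos (2 * antideriv f₁ τ), -Real.sin (2 * antideriv f₁ τ),
    -(Real.cos (2 * antideriv f₁ τ) * antideriv f₀ τ),
    Real.sin (2 * antideriv f₁ τ) * antideriv f₀ τ]

theorem continuous_conjCoeff {f₀ f₁ : ℝ → ℝ} (hf₀ : Continuous f₀) (hf₁ : Continuous f₁)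
    (k : Fin 5) : Continuous fun τ => conjCoeff f₀ f₁ τ k := by
  have h0 := continuous_antideriv hf₀
  have h1 := continuous_antideriv hf₁
  fin_cases k <;> simp only [conjCoeff] <;> simp <;> fun_prop

theorem periodic_conjCoeff {f₀ f₁ : ℝ → ℝ} {t₀ : ℝ} (hf₀ : Continuous f₀) (hf₁ : Continuous f₁)
    (hper₀ : Function.Periodic f₀ t₀) (hper₁ : Function.Periodic f₁ t₀)
    (hmean₀ : (∫ τ in (0 : ℝ)..t₀, f₀ τ) = 0) (hmean₁ : (∫ τ in (0 : ℝ)..t₀, f₁ τ) = 0) :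
    Function.Periodic (conjCoeff f₀ f₁) t₀ := by
  intro τ
  rw [conjCoeff, conjCoeff, periodic_antideriv hf₀ hper₀ hmean₀ τ,
    periodic_antideriv hf₁ hper₁ hmean₁ τ]

end Averaging

/-! ### Conjugation of the Dirac operator by the fast unitary. -/

section Dirac

/-- The rotation `cos θ - i sin θ σ₁`. -/
def rotation (θ : ℝ) : Matrix (Fin 2) (Fin 2) ℂ :=
  ((Real.cos θ : ℝ) : ℂ) • (1 : Matrix (Fin 2) (Fin 2) ℂ)
    - (Complex.I * ((Real.sin θ : ℝ) : ℂ)) • pauli1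

/-- The phase `exp (-i θ v(y))`. -/
def phase (v : ℝ → ℝ) (θ y : ℝ) : ℂ := Complex.exp (-Complex.I * ((θ * v y : ℝ) : ℂ))

theorem fastUnitary_eq (f₀ f₁ v : ℝ → ℝ) (τ : ℝ) (z : Plane) :
    fastUnitary f₀ f₁ v τ z = phase v (antideriv f₀ τ) (z 1) • rotation (antideriv f₁ τ) := rfl

theorem norm_phase (v : ℝ → ℝ) (θ y : ℝ) : ‖phase v θ y‖ = 1 := by
  rw [phase, Complex.norm_exp]
  simp

theorem contDiff_ofReal_comp {v : ℝ → ℝ} (hv : ContDiff ℝ ∞ v) :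
    ContDiff ℝ ∞ fun y => (v y : ℂ) :=
  Complex.ofRealCLM.contDiff.comp hv

theorem contDiff_phase {v : ℝ → ℝ} (hv : ContDiff ℝ ∞ v) (θ : ℝ) :
    ContDiff ℝ ∞ (phase v θ) :=
  (contDiff_const.mul (contDiff_ofReal_comp (contDiff_const.mul hv))).cexp

theorem hasDerivAt_phase {v : ℝ → ℝ} (hv : ContDiff ℝ ∞ v) (θ y : ℝ) :
    HasDerivAt (phase v θ) (phase v θ y * (-Complex.I * ((θ * deriv v y : ℝ) : ℂ))) y := by
  have h1 : HasDerivAt (fun y => θ * v y) (θ * deriv v y) y :=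
    ((hv.differentiable (by simp) y).hasDerivAt).const_mul θ
  exact (h1.ofReal_comp.const_mul (-Complex.I)).cexp

theorem pauli1_mul_rotation (θ : ℝ) : pauli1 * rotation θ = rotation θ * pauli1 := by
  simp [rotation, mul_sub, sub_mul]

/-- Since `σ₁` anticommutes with `σ₂`, conjugation by the rotation doubles the angle, and `σ₁ σ₂ = i
σ₃` brings in `σ₃`. -/
theorem pauli2_mul_rotation (θ : ℝ) :
    pauli2 * rotation θ = rotation θ * (((Real.cos (2 * θ) : ℝ) : ℂ) • pauli2
      - ((Real.sin (2 * θ) : ℝ) : ℂ) • pauli3) := by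
  have h : (Complex.cos θ) ^ 2 + (Complex.sin θ) ^ 2 = 1 := by
    rw [add_comm]; exact Complex.sin_sq_add_cos_sq _
  have hI := Complex.I_sq
  ext i j
  fin_cases i <;> fin_cases j <;>
    simp [rotation, pauli1, pauli2, pauli3, Matrix.mul_apply, Complex.cos_two_mul,
      Complex.sin_two_mul] <;> grind

theorem conjTranspose_rotation_mul (θ : ℝ) : (rotation θ)ᴴ * rotation θ = 1 := by
  have h : (Complex.cos θ) ^ 2 + (Complex.sin θ) ^ 2 = 1 := by
    rw [add_comm]; exact Complex.sin_sq_add_cos_sq _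
  have hI := Complex.I_sq
  ext i j
  fin_cases i <;> fin_cases j <;>
    simp [rotation, pauli1, Matrix.mul_apply, ← Complex.cos_conj, ← Complex.sin_conj] <;> grind

theorem conjTranspose_fastUnitary_mul (f₀ f₁ v : ℝ → ℝ) (τ : ℝ) (z : Plane) :
    (fastUnitary f₀ f₁ v τ z)ᴴ * fastUnitary f₀ f₁ v τ z = 1 := by
  rw [fastUnitary_eq, Matrix.conjTranspose_smul, Matrix.smul_mul, Matrix.mul_smul,
    conjTranspose_rotation_mul, smul_smul, Complex.star_def, Complex.conj_mul', norm_phase]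
  simp

theorem norm_act_of_conjTranspose_mul {A : Matrix (Fin 2) (Fin 2) ℂ} (hA : Aᴴ * A = 1)
    (x : Spinor) : ‖act A x‖ = ‖x‖ := by
  have h1 : inner ℂ (act A x) (act A x) = inner ℂ x x := by
    rw [inner_act, ← mul_act, hA, one_act]
  rw [inner_self_eq_norm_sq_to_K, inner_self_eq_norm_sq_to_K] at h1
  have h2 : ‖act A x‖ ^ 2 = ‖x‖ ^ 2 := by exact_mod_cast h1
  exact (sq_eq_sq₀ (norm_nonneg _) (norm_nonneg _)).1 h2

theorem norm_conjTranspose_fastUnitary_act (f₀ f₁ v : ℝ → ℝ) (τ : ℝ) (z : Plane) (x : Spinor) :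
    ‖act (fastUnitary f₀ f₁ v τ z)ᴴ x‖ = ‖x‖ := by
  refine norm_act_of_conjTranspose_mul ?_ x
  rw [Matrix.conjTranspose_conjTranspose]
  exact mul_eq_one_comm.1 (conjTranspose_fastUnitary_mul f₀ f₁ v τ z)

theorem combination_component_apply {a : ℝ → ℂ} (ha : ContDiff ℝ ∞ a) (p : Fin 5 → ℝ)
    (χ : testSpace) (z : Plane) :
    (combination (component a ha) p χ).1 z
      = (p 0 : ℂ) • act (-Complex.I • pauli1) (partialDeriv 0 χ.1 z)
        + (p 1 : ℂ) • act (-Complex.I • pauli2) (partialDeriv 1 χ.1 z)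
        + (p 2 : ℂ) • act (-Complex.I • pauli3) (partialDeriv 1 χ.1 z)
        + (p 3 : ℂ) • a (z 1) • act pauli2 (χ.1 z)
        + (p 4 : ℂ) • a (z 1) • act pauli3 (χ.1 z) := by
  rw [← partialDeriv_act _ _ (test_differentiable χ z), ← partialDeriv_act _ _
    (test_differentiable χ z), ← partialDeriv_act _ _ (test_differentiable χ z)]
  simp only [combination, Fin.sum_univ_five]
  rfl

theorem one_div_I : (1 / Complex.I : ℂ) = -Complex.I := by
  rw [one_div, Complex.inv_I]

/-- The operator `D · σ` on test functions. -/
def diracOp : testSpace →ₗ[ℂ] testSpace :=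
  matOp (-Complex.I • pauli1) ∘ₗ derivOp 0 + matOp (-Complex.I • pauli2) ∘ₗ derivOp 1

theorem diracOp_apply (χ : testSpace) : (diracOp χ).1 = dirac χ.1 := by
  funext z
  rw [dirac, one_div_I, ← smul_act, ← smul_act]
  rfl

variable {v : ℝ → ℝ} (hv : ContDiff ℝ ∞ v)

theorem contDiff_deriv_ofReal (hv : ContDiff ℝ ∞ v) :
    ContDiff ℝ ∞ fun y => ((deriv v y : ℝ) : ℂ) :=
  contDiff_ofReal_comp (v := deriv v) ((contDiff_infty_iff_deriv (𝕜 := ℝ)).1 hv).2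

/-- Multiplication of test functions by `U₋₁`, as a function of the values of `F₀` and `F₁`. -/
def rotationOp (θ₀ θ₁ : ℝ) : testSpace →ₗ[ℂ] testSpace :=
  coordOp (phase v θ₀) (contDiff_phase hv θ₀) ∘ₗ matOp (rotation θ₁)

theorem rotationOp_apply (f₀ f₁ : ℝ → ℝ) (τ : ℝ) (χ : testSpace) :
    (rotationOp hv (antideriv f₀ τ) (antideriv f₁ τ) χ).1
      = fun z => act (fastUnitary f₀ f₁ v τ z) (χ.1 z) := by
  funext z
  rw [fastUnitary_eq, smul_act]
  rfl

/-- The `σ₁ ∂_x` part passes through unchanged, while `σ₂` is turned by twice the angle. The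
`y`-derivative of the phase adds `-i F₀ v'`, which after multiplication by `-i σ₂` yields the two
zero-order components. This intertwining form also serves the evolution equation, where test
functions are rotated. -/
theorem diracOp_rotationOp (f₀ f₁ : ℝ → ℝ) (τ : ℝ) (χ : testSpace) :
    diracOp (rotationOp hv (antideriv f₀ τ) (antideriv f₁ τ) χ)
      = rotationOp hv (antideriv f₀ τ) (antideriv f₁ τ)
        (combination (component _ (contDiff_deriv_ofReal hv)) (conjCoeff f₀ f₁ τ) χ) := by
  set θ := antideriv f₁ τ with hθ
  set θ₀ := antideriv f₀ τ with hθ₀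
  ext1; funext z
  have hd : ∀ w, deriv (phase v θ₀) w = phase v θ₀ w * (-Complex.I * ((θ₀ * deriv v w : ℝ) : ℂ)) :=
    fun w => (hasDerivAt_phase hv θ₀ w).deriv
  have e0 : partialDeriv 0 (rotationOp hv θ₀ θ χ).1 z
      = phase v θ₀ (z 1) • act (rotation θ) (partialDeriv 0 χ.1 z) := by
    have : derivOp 0 (rotationOp hv θ₀ θ χ)
        = coordOp _ (contDiff_phase hv θ₀) (matOp (rotation θ) (derivOp 0 χ)) := by
      rw [rotationOp, LinearMap.comp_apply, derivOp_zero_coordOp, derivOp_matOp]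
    exact congrFun (congrArg Subtype.val this) z
  have e1 : partialDeriv 1 (rotationOp hv θ₀ θ χ).1 z
      = phase v θ₀ (z 1) • act (rotation θ) (partialDeriv 1 χ.1 z)
        + (phase v θ₀ (z 1) * (-Complex.I * ((θ₀ * deriv v (z 1) : ℝ) : ℂ))) •
          act (rotation θ) (χ.1 z) := by
    have : derivOp 1 (rotationOp hv θ₀ θ χ)
        = coordOp _ (contDiff_phase hv θ₀) (matOp (rotation θ) (derivOp 1 χ))
          + coordOp _ (contDiff_deriv (contDiff_phase hv θ₀)) (matOp (rotation θ) χ) := by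
      rw [rotationOp, LinearMap.comp_apply, derivOp_one_coordOp, derivOp_matOp]
    rw [← hd]
    exact congrFun (congrArg Subtype.val this) z
  have h1 : (diracOp (rotationOp hv θ₀ θ χ)).1 z
      = act (-Complex.I • pauli1) (partialDeriv 0 (rotationOp hv θ₀ θ χ).1 z)
        + act (-Complex.I • pauli2) (partialDeriv 1 (rotationOp hv θ₀ θ χ).1 z) := rfl
  have h2 : ∀ η : testSpace, (rotationOp hv θ₀ θ η).1 z
      = phase v θ₀ (z 1) • act (rotation θ) (η.1 z) := fun η => rfl
  have m1 : ∀ x, act pauli1 (act (rotation θ) x) = act (rotation θ) (act pauli1 x) := fun x => by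
    rw [← mul_act, ← mul_act, pauli1_mul_rotation]
  have m2 : ∀ x, act pauli2 (act (rotation θ) x)
      = act (rotation θ) (((Real.cos (2 * θ) : ℝ) : ℂ) • act pauli2 x
        - ((Real.sin (2 * θ) : ℝ) : ℂ) • act pauli3 x) := fun x => by
    rw [← mul_act, pauli2_mul_rotation, mul_act, sub_act, smul_act, smul_act]
  have c0 : conjCoeff f₀ f₁ τ 0 = 1 := rfl
  have c1 : conjCoeff f₀ f₁ τ 1 = Real.cos (2 * θ) := rfl
  have c2 : conjCoeff f₀ f₁ τ 2 = -Real.sin (2 * θ) := rfl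
  have c3 : conjCoeff f₀ f₁ τ 3 = -(Real.cos (2 * θ) * θ₀) := rfl
  have c4 : conjCoeff f₀ f₁ τ 4 = Real.sin (2 * θ) * θ₀ := rfl
  rw [h1, h2, e0, e1, combination_component_apply, c0, c1, c2, c3, c4]
  simp only [act_add, act_sub, act_smul, smul_act, m1, m2]
  match_scalars <;> ring_nf
  all_goals
    rw [Complex.I_sq]
    ring

end Dirac
-- The effective Hamiltonian as a time average.
section Effective

variable {v : ℝ → ℝ} (hv : ContDiff ℝ ∞ v)

theorem conjugated_eq_combination (f₀ f₁ : ℝ → ℝ) (τ : ℝ) (χ : testSpace) (z : Plane) :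
    conjugated f₀ f₁ v τ χ.1 z
      = (combination (component _ (contDiff_deriv_ofReal hv)) (conjCoeff f₀ f₁ τ) χ).1 z := by
  rw [conjugated, ← rotationOp_apply hv, ← diracOp_apply, diracOp_rotationOp, rotationOp_apply,
    ← mul_act, conjTranspose_fastUnitary_mul, one_act]

/-- The coefficients of the effective Hamiltonian with respect to the five components. -/
def meanCoeff (t₀ : ℝ) (f₀ f₁ : ℝ → ℝ) (k : Fin 5) : ℝ :=
  timeAverage t₀ fun τ => conjCoeff f₀ f₁ τ k

theorem timeAverage_neg (t₀ : ℝ) (g : ℝ → ℝ) :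
    timeAverage t₀ (fun τ => -g τ) = -timeAverage t₀ g := by
  rw [timeAverage, timeAverage, intervalIntegral.integral_neg, mul_neg]

theorem effective_eq_combination {t₀ : ℝ} (ht₀ : 0 < t₀) (f₀ f₁ : ℝ → ℝ) (χ : testSpace) :
    effective t₀ f₀ f₁ v χ.1
      = (combination (component _ (contDiff_deriv_ofReal hv)) (meanCoeff t₀ f₀ f₁) χ).1 := by
  funext z
  have q0 : meanCoeff t₀ f₀ f₁ 0 = 1 := by
    change timeAverage t₀ (fun _ => 1) = 1
    rw [timeAverage, intervalIntegral.integral_const, sub_zero, smul_eq_mul, mul_one,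
      one_div_mul_cancel ht₀.ne']
  have q1 : meanCoeff t₀ f₀ f₁ 1 = timeAverage t₀ fun τ => Real.cos (2 * antideriv f₁ τ) := rfl
  have q2 : meanCoeff t₀ f₀ f₁ 2 = -timeAverage t₀ fun τ => Real.sin (2 * antideriv f₁ τ) :=
    timeAverage_neg _ _
  have q3 : meanCoeff t₀ f₀ f₁ 3
      = -timeAverage t₀ fun τ => Real.cos (2 * antideriv f₁ τ) * antideriv f₀ τ :=
    timeAverage_neg _ _
  have q4 : meanCoeff t₀ f₀ f₁ 4
      = timeAverage t₀ fun τ => Real.sin (2 * antideriv f₁ τ) * antideriv f₀ τ := rfl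
  rw [combination_component_apply, q0, q1, q2, q3, q4, effective, one_div_I, matrixY, matrixM]
  simp only [neg_act, sub_act, smul_act]
  match_scalars <;> ring

-- At a fixed point the conjugated field is a combination of five vectors independent of `τ`, so
-- only scalar coefficients are averaged.
include hv in
theorem effective_eq_average {t₀ : ℝ} (ht₀ : 0 < t₀) {f₀ f₁ : ℝ → ℝ} (hf₀ : Continuous f₀)
    (hf₁ : Continuous f₁) (χ : testSpace) (z : Plane) :
    effective t₀ f₀ f₁ v χ.1 z
      = (1 / t₀) • ∫ τ in (0 : ℝ)..t₀, conjugated f₀ f₁ v τ χ.1 z := by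
  set e : Fin 5 → Spinor := fun k => (component _ (contDiff_deriv_ofReal hv) k χ).1 z
  have hcomb : ∀ p : Fin 5 → ℝ,
      (combination (component _ (contDiff_deriv_ofReal hv)) p χ).1 z = ∑ k, p k • e k := by
    intro p
    simp only [combination, Fin.sum_univ_five]
    rfl
  have h1 : ∀ τ, conjugated f₀ f₁ v τ χ.1 z = ∑ k, conjCoeff f₀ f₁ τ k • e k := fun τ => by
    rw [conjugated_eq_combination hv, hcomb]
  simp only [h1]
  rw [effective_eq_combination hv ht₀, hcomb, intervalIntegral.integral_finsetSum
    (f := fun k τ => conjCoeff f₀ f₁ τ k • e k) fun k _ => ((continuous_conjCoeff hf₀ hf₁ k).smul continuous_const).intervalIntegrable _ _,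
    Finset.smul_sum]
  refine Finset.sum_congr rfl fun k _ => ?_
  rw [intervalIntegral.integral_smul_const, smul_smul]
  rfl

end Effective

/-! ### The evolution equation in the rotating frame. -/

section Evolution

/-- A product rule for a moving test vector: `Φ` is differentiable in norm, while `ψ` is merely
continuous and differentiable against the frozen vector `Φ t`. -/
theorem hasDerivWithinAt_inner_of_weak {H : Type*} [NormedAddCommGroup H] [InnerProductSpace ℂ H]
    {Φ ψ : ℝ → H} {Φ' : H} {d : ℂ} {S : Set ℝ} {t : ℝ} (hΦ : HasDerivWithinAt Φ Φ' S t)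
    (hψ : ContinuousWithinAt ψ S t)
    (hd : HasDerivWithinAt (fun s => inner ℂ (Φ t) (ψ s)) d S t) :
    HasDerivWithinAt (fun s => inner ℂ (Φ s) (ψ s)) (inner ℂ Φ' (ψ t) + d) S t := by
  have h1 : HasDerivWithinAt (fun s => inner ℂ (Φ s - Φ t) (ψ s)) (inner ℂ Φ' (ψ t)) S t := by
    rw [hasDerivWithinAt_iff_tendsto_slope] at hΦ ⊢
    have h2 : Filter.Tendsto ψ (nhdsWithin t (S \ {t})) (nhds (ψ t)) :=
      hψ.tendsto.mono_left (nhdsWithin_mono _ sdiff_subset)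
    refine (hΦ.inner h2).congr fun s => ?_
    rw [slope_def_module, slope_def_module, sub_self, inner_zero_left, sub_zero,
      inner_smul_left_eq_smul]
  have h2 := h1.add hd
  refine h2.congr (fun s _ => ?_) ?_
  · rw [Pi.add_apply, ← inner_add_left, sub_add_cancel]
  · rw [Pi.add_apply, ← inner_add_left, sub_add_cancel]

theorem norm_exp_I_mul_sub_le (x : ℝ) :
    ‖Complex.exp (-Complex.I * (x : ℂ)) - 1 - -Complex.I * (x : ℂ)‖ ≤ 3 * x ^ 2 := by
  have hx : ‖-Complex.I * (x : ℂ)‖ = |x| := by simp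
  rcases le_or_gt |x| 1 with h | h
  · have := Complex.norm_exp_sub_one_sub_id_le (hx.le.trans h)
    rw [hx, sq_abs] at this
    nlinarith [sq_nonneg x]
  · have h1 : ‖Complex.exp (-Complex.I * (x : ℂ))‖ = 1 := by
      rw [Complex.norm_exp]; simp
    have h2 : ‖Complex.exp (-Complex.I * (x : ℂ)) - 1 - -Complex.I * (x : ℂ)‖ ≤ 1 + 1 + |x| := by
      refine (norm_sub_le _ _).trans (add_le_add ((norm_sub_le _ _).trans ?_) hx.le)
      rw [h1, norm_one]
    refine h2.trans ?_
    rw [← sq_abs]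
    nlinarith

variable {v : ℝ → ℝ} (hv : ContDiff ℝ ∞ v)

/-- As `v` may be unbounded, differentiability is claimed only on test functions. The Taylor
remainder of the exponential is quadratic in `h v`, and `v² χ` is again a test function. -/
theorem hasDerivAt_toState_phase (χ : testSpace) (θ : ℝ) :
    HasDerivAt (fun θ => toState (coordOp (phase v θ) (contDiff_phase hv θ) χ))
      (toState (coordOp (phase v θ) (contDiff_phase hv θ)
        (-Complex.I • coordOp _ (contDiff_ofReal_comp hv) χ))) θ := by
  set χ₁ := coordOp _ (contDiff_ofReal_comp hv) χ
  set χ₂ := coordOp _ (contDiff_ofReal_comp hv) χ₁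
  rw [hasDerivAt_iff_isLittleO_nhds_zero]
  have hbound : ∀ h : ℝ, ‖toState (coordOp (phase v (θ + h)) (contDiff_phase hv (θ + h)) χ)
      - toState (coordOp (phase v θ) (contDiff_phase hv θ) χ)
      - h • toState (coordOp (phase v θ) (contDiff_phase hv θ) (-Complex.I • χ₁))‖
        ≤ 3 * ‖toState χ₂‖ * ‖h ^ 2‖ := by
    intro h
    have h1 : h • toState (coordOp (phase v θ) (contDiff_phase hv θ) (-Complex.I • χ₁))
        = toState ((h : ℂ) • coordOp (phase v θ) (contDiff_phase hv θ) (-Complex.I • χ₁)) := by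
      rw [map_smul]; rfl
    rw [h1, ← map_sub, ← map_sub]
    have := norm_toState_le (χ := coordOp (phase v (θ + h)) (contDiff_phase hv (θ + h)) χ
      - coordOp (phase v θ) (contDiff_phase hv θ) χ
      - (h : ℂ) • coordOp (phase v θ) (contDiff_phase hv θ) (-Complex.I • χ₁)) (η := χ₂)
      (C := 3 * h ^ 2) fun z => ?_
    · rw [Real.norm_eq_abs, abs_of_nonneg (sq_nonneg h)]
      linarith
    · change ‖phase v (θ + h) (z 1) • χ.1 z - phase v θ (z 1) • χ.1 z
        - (h : ℂ) • (phase v θ (z 1) • (-Complex.I • ((v (z 1) : ℂ) • χ.1 z)))‖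
        ≤ 3 * h ^ 2 * ‖(v (z 1) : ℂ) • ((v (z 1) : ℂ) • χ.1 z)‖
      have e1 : phase v (θ + h) (z 1)
          = phase v θ (z 1) * Complex.exp (-Complex.I * ((h * v (z 1) : ℝ) : ℂ)) := by
        rw [phase, phase, ← Complex.exp_add]
        congr 1
        push_cast
        ring
      have e2 : phase v (θ + h) (z 1) • χ.1 z - phase v θ (z 1) • χ.1 z
          - (h : ℂ) • (phase v θ (z 1) • (-Complex.I • ((v (z 1) : ℂ) • χ.1 z)))
          = (phase v θ (z 1) * (Complex.exp (-Complex.I * ((h * v (z 1) : ℝ) : ℂ)) - 1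
            - -Complex.I * ((h * v (z 1) : ℝ) : ℂ))) • χ.1 z := by
        rw [e1]
        match_scalars
        ring
      rw [e2, norm_smul, norm_mul, norm_phase, one_mul, smul_smul, norm_smul, norm_mul,
        Complex.norm_real, ← mul_assoc]
      refine mul_le_mul_of_nonneg_right ((norm_exp_I_mul_sub_le _).trans (le_of_eq ?_))
        (norm_nonneg _)
      rw [← pow_two, Real.norm_eq_abs, sq_abs]
      ring
  refine Asymptotics.IsBigO.trans_isLittleO (Asymptotics.IsBigO.of_bound _ (.of_forall hbound)) ?_
  exact Asymptotics.isLittleO_pow_id one_lt_two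

theorem hasDerivAt_toState_rotationOp {f₀ f₁ : ℝ → ℝ} (hf₀ : Continuous f₀) (hf₁ : Continuous f₁)
    (χ : testSpace) (τ : ℝ) :
    HasDerivAt (fun τ => toState (rotationOp hv (antideriv f₀ τ) (antideriv f₁ τ) χ))
      (-Complex.I • toState ((f₁ τ : ℂ) • matOp pauli1
          (rotationOp hv (antideriv f₀ τ) (antideriv f₁ τ) χ)
        + (f₀ τ : ℂ) • coordOp _ (contDiff_ofReal_comp hv)
          (rotationOp hv (antideriv f₀ τ) (antideriv f₁ τ) χ))) τ := by
  set P : ℝ → testSpace → testSpace := fun θ η => coordOp (phase v θ) (contDiff_phase hv θ) η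
  have hrot : ∀ θ₀ θ₁ η, rotationOp hv θ₀ θ₁ η = ((Real.cos θ₁ : ℝ) : ℂ) • P θ₀ η
      - (Complex.I * ((Real.sin θ₁ : ℝ) : ℂ)) • P θ₀ (matOp pauli1 η) := by
    intro θ₀ θ₁ η
    ext1; funext z
    change phase v θ₀ (z 1) • act (rotation θ₁) (η.1 z)
      = ((Real.cos θ₁ : ℝ) : ℂ) • (phase v θ₀ (z 1) • η.1 z)
        - (Complex.I * ((Real.sin θ₁ : ℝ) : ℂ)) • (phase v θ₀ (z 1) • act pauli1 (η.1 z))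
    rw [rotation, sub_act, smul_act, smul_act, one_act]
    module
  have hP : ∀ η, HasDerivAt (fun τ => toState (P (antideriv f₀ τ) η))
      (f₀ τ • toState (P (antideriv f₀ τ) (-Complex.I • coordOp _ (contDiff_ofReal_comp hv) η)))
      τ := fun η =>
    (hasDerivAt_toState_phase hv η (antideriv f₀ τ)).scomp τ (hasDerivAt_antideriv hf₀ τ)
  have hF₁ := hasDerivAt_antideriv hf₁ τ
  have hc := (hF₁.cos.ofReal_comp).smul (hP χ)
  have hs := ((hF₁.sin.ofReal_comp).const_mul Complex.I).smul (hP (matOp pauli1 χ))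
  have hd := hc.sub hs
  have hfun : (fun τ => toState (rotationOp hv (antideriv f₀ τ) (antideriv f₁ τ) χ))
      = (fun τ => ((Real.cos (antideriv f₁ τ) : ℝ) : ℂ)) • (fun τ => toState (P (antideriv f₀ τ) χ))
        - (fun τ => Complex.I * ((Real.sin (antideriv f₁ τ) : ℝ) : ℂ)) •
          (fun τ => toState (P (antideriv f₀ τ) (matOp pauli1 χ))) := by
    funext τ
    rw [hrot, map_sub, map_smul, map_smul]
    rfl
  rw [hfun]
  refine hd.congr_deriv ?_
  have hr : ∀ (c : ℝ) (x : State), c • x = (c : ℂ) • x := fun _ _ => rfl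
  have hσσ : matOp pauli1 (matOp pauli1 χ) = χ := by
    ext1; funext z
    change act pauli1 (act pauli1 (χ.1 z)) = χ.1 z
    have : pauli1 * pauli1 = 1 := by
      ext i j; fin_cases i <;> fin_cases j <;> simp [pauli1]
    rw [← mul_act, this, one_act]
  have hPσ : ∀ θ η, matOp pauli1 (P θ η) = P θ (matOp pauli1 η) := fun θ η =>
    (coordOp_matOp _ _ _ _).symm
  have hPv : ∀ θ η, coordOp _ (contDiff_ofReal_comp hv) (P θ η)
      = P θ (coordOp _ (contDiff_ofReal_comp hv) η) := fun θ η => by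
    ext1; funext z
    exact smul_comm (v (z 1) : ℂ) (phase v θ (z 1)) (η.1 z)
  have hPs : ∀ θ (c : ℂ) η, P θ (c • η) = c • P θ η := fun θ c η => map_smul _ c η
  simp only [hrot, map_add, map_sub, map_smul, hPσ, hPv, hPs, hσσ, hr]
  match_scalars <;> ring_nf
  all_goals try (rw [Complex.I_sq]; ring)

/-- `(U₋₁(τ)* f)(z)`. -/
def unwound (f₀ f₁ v : ℝ → ℝ) (τ : ℝ) (f : Plane → Spinor) (z : Plane) : Spinor :=
  act (fastUnitary f₀ f₁ v τ z)ᴴ (f z)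

include hv in
theorem memLp_unwound (f₀ f₁ : ℝ → ℝ) (τ : ℝ) (f : State) :
    MemLp (unwound f₀ f₁ v τ f) 2 volume := by
  refine (Lp.memLp f).of_le ?_ (.of_forall fun z =>
    (norm_conjTranspose_fastUnitary_act f₀ f₁ v τ z (f z)).le)
  have h1 : unwound f₀ f₁ v τ f = fun z => star (phase v (antideriv f₀ τ) (z 1)) •
      (Matrix.toEuclideanCLM (n := Fin 2) (𝕜 := ℂ) (rotation (antideriv f₁ τ))ᴴ) (f z) := by
    funext z
    rw [unwound, fastUnitary_eq, Matrix.conjTranspose_smul, smul_act]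
    rfl
  rw [h1]
  exact (contDiff_comp_coord (contDiff_phase hv _)).continuous.star.aestronglyMeasurable.smul
    ((Matrix.toEuclideanCLM (n := Fin 2) (𝕜 := ℂ)
      (rotation (antideriv f₁ τ))ᴴ).continuous.comp_aestronglyMeasurable
      (Lp.aestronglyMeasurable f))

/-- The state `U₋₁(τ)* f`. -/
def unwind (f₀ f₁ : ℝ → ℝ) (τ : ℝ) (f : State) : State :=
  (memLp_unwound hv f₀ f₁ τ f).toLp

theorem coeFn_unwind (f₀ f₁ : ℝ → ℝ) (τ : ℝ) (f : State) :
    unwind hv f₀ f₁ τ f =ᵐ[volume] unwound f₀ f₁ v τ f :=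
  (memLp_unwound hv f₀ f₁ τ f).coeFn_toLp

theorem norm_unwind (f₀ f₁ : ℝ → ℝ) (τ : ℝ) (f : State) : ‖unwind hv f₀ f₁ τ f‖ = ‖f‖ := by
  rw [Lp.norm_def, Lp.norm_def]
  congr 1
  refine eLpNorm_congr_norm_ae ?_
  filter_upwards [coeFn_unwind hv f₀ f₁ τ f] with z hz
  rw [hz]
  exact norm_conjTranspose_fastUnitary_act f₀ f₁ v τ z (f z)

theorem unwind_zero (f₀ f₁ : ℝ → ℝ) (f : State) : unwind hv f₀ f₁ 0 f = f := by
  refine Lp.ext ((coeFn_unwind hv f₀ f₁ 0 f).trans (.of_forall fun z => ?_))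
  simp [unwound, fastUnitary, antideriv_zero, one_act]

theorem inner_toState_unwind (f₀ f₁ : ℝ → ℝ) (τ : ℝ) (f : State) (χ : testSpace) :
    inner ℂ (toState χ) (unwind hv f₀ f₁ τ f)
      = inner ℂ (toState (rotationOp hv (antideriv f₀ τ) (antideriv f₁ τ) χ)) f := by
  rw [inner_toState, inner_toState]
  refine integral_congr_ae ?_
  filter_upwards [coeFn_unwind hv f₀ f₁ τ f] with z hz
  rw [hz, rotationOp_apply, inner_act]
  rfl

/-- `U₋₁*` is pointwise unitary, so it can be applied inside the norm. -/
theorem averagingError_eq (f₀ f₁ : ℝ → ℝ) (ε t : ℝ) (ψε ψ : ℝ → State) :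
    averagingError f₀ f₁ v ε t ψε ψ
      = ENNReal.ofReal ‖unwind hv f₀ f₁ (t / ε) (ψε t) - ψ t‖ := by
  rw [Lp.norm_def, ENNReal.ofReal_toReal (Lp.eLpNorm_ne_top _), averagingError]
  refine eLpNorm_congr_norm_ae ?_
  filter_upwards [coeFn_unwind hv f₀ f₁ (t / ε) (ψε t),
    Lp.coeFn_sub (unwind hv f₀ f₁ (t / ε) (ψε t)) (ψ t)] with z h1 h2
  rw [h2, Pi.sub_apply, h1, unwound, ← norm_conjTranspose_fastUnitary_act f₀ f₁ v (t / ε) z,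
    act_sub, ← mul_act, conjTranspose_fastUnitary_mul, one_act]

/-- The unitary is moved onto the test function, which then depends on time. The derivative of this
rotated test function and the potential in the weak equation contribute opposite terms of order
`1/ε`. -/
theorem hasDerivWithinAt_inner_unwind {f₀ f₁ : ℝ → ℝ} (hf₀ : Continuous f₀)
    (hf₁ : Continuous f₁) {ε : ℝ} {φ : State} {ψε : ℝ → State}
    (hψ : IsSolution (modulated f₀ f₁ v ε) φ ψε) (χ : testSpace) {t : ℝ} (ht : 0 ≤ t) :
    HasDerivWithinAt (fun s => inner ℂ (toState χ) (unwind hv f₀ f₁ (s / ε) (ψε s)))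
      (-Complex.I * inner ℂ (toState (combination (component _ (contDiff_deriv_ofReal hv))
        (conjCoeff f₀ f₁ (t / ε)) χ)) (unwind hv f₀ f₁ (t / ε) (ψε t))) (Ici 0) t := by
  set χt := rotationOp hv (antideriv f₀ (t / ε)) (antideriv f₁ (t / ε)) χ with hχt
  set X := (f₁ (t / ε) : ℂ) • matOp pauli1 χt
    + (f₀ (t / ε) : ℂ) • coordOp _ (contDiff_ofReal_comp hv) χt with hX
  have hdiv : HasDerivAt (fun s : ℝ => s / ε) ε⁻¹ t := by
    simpa using (hasDerivAt_id t).div_const ε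
  have hΦ := ((hasDerivAt_toState_rotationOp hv hf₀ hf₁ χ (t / ε)).scomp t hdiv).hasDerivWithinAt
    (s := Ici 0)
  have hd := hψ.equation χt χt.2 t ht
  have hmod : modulated f₀ f₁ v ε t χt.1 = (diracOp χt + ((ε⁻¹ : ℝ) : ℂ) • X).1 := by
    funext z
    rw [modulated, ← diracOp_apply]
    change (diracOp χt).1 z + _ = (diracOp χt).1 z + ((ε⁻¹ : ℝ) : ℂ) •
      ((f₁ (t / ε) : ℂ) • act pauli1 (χt.1 z) + (f₀ (t / ε) : ℂ) • ((v (z 1) : ℂ) • χt.1 z))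
    rw [one_div, smul_smul (f₀ (t / ε) : ℂ), Complex.ofReal_mul]
  rw [hmod, ← inner_toState] at hd
  simp only [← inner_toState] at hd
  have h := hasDerivWithinAt_inner_of_weak hΦ (hψ.continuousOn t ht) hd
  simp only [inner_toState_unwind]
  refine h.congr_deriv ?_
  clear_value X
  rw [← diracOp_rotationOp hv, ← hχt, ← hX, map_add, map_smul, one_div_I]
  have hr : ∀ (c : ℝ) (x : State), c • x = (c : ℂ) • x := fun _ _ => rfl
  rw [hr, inner_smul_left, inner_smul_left, inner_add_left, inner_smul_left, map_neg,
    Complex.conj_I, Complex.conj_ofReal]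
  ring

end Evolution

/-! ### Assembling the averaging estimate. -/

section Estimate

variable {v : ℝ → ℝ} (hv : ContDiff ℝ ∞ v)

-- The term with `B` is the cost of the corrector at the final time. It is kept separate because it
-- carries no factor `t` and vanishes at multiples of the fast period.
include hv in
theorem exists_averaging_constants {t₀ : ℝ} (ht₀ : 0 < t₀) {f₀ f₁ : ℝ → ℝ}
    (hf₀ : Continuous f₀) (hf₁ : Continuous f₁)
    (hper₀ : Function.Periodic f₀ t₀) (hper₁ : Function.Periodic f₁ t₀)
    (hmean₀ : (∫ τ in (0 : ℝ)..t₀, f₀ τ) = 0) (hmean₁ : (∫ τ in (0 : ℝ)..t₀, f₁ τ) = 0)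
    (hv' : ∃ K : ℝ, ∀ y, |deriv v y| ≤ K) (hv'' : ∃ K : ℝ, ∀ y, |deriv (deriv v) y| ≤ K) :
    ∃ A B : ℝ, 0 ≤ A ∧ 0 ≤ B ∧ ∀ (ε : ℝ), 0 < ε → ∀ (φ : State) (ψε ψ : ℝ → State),
      IsSolution (modulated f₀ f₁ v ε) φ ψε →
      IsSolution (fun _ => effective t₀ f₀ f₁ v) φ ψ → ∀ t N : ℝ, 0 ≤ t →
      (∀ s ∈ Icc 0 t, h2Norm (ψ s) < ENNReal.ofReal N) →
      ‖unwind hv f₀ f₁ (t / ε) (ψε t) - ψ t‖ ≤ (A * t + B) * ε * N ∧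
      ((∃ n : ℕ, t = n * (ε * t₀)) →
        ‖unwind hv f₀ f₁ (t / ε) (ψε t) - ψ t‖ ≤ A * t * ε * N) := by
  obtain ⟨K₁, hK₁⟩ := hv'
  obtain ⟨K₂, hK₂⟩ := hv''
  set a : ℝ → ℂ := fun y => ((deriv v y : ℝ) : ℂ) with hadef
  have ha : ContDiff ℝ ∞ a := contDiff_deriv_ofReal hv
  set K := max 1 (max K₁ K₂)
  have hK1 : 1 ≤ K := le_max_left _ _
  have hKa : ∀ y, ‖a y‖ ≤ K := fun y => by
    rw [hadef, Complex.norm_real]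
    exact (hK₁ y).trans ((le_max_left _ _).trans (le_max_right _ _))
  have hKa' : ∀ y, ‖deriv a y‖ ≤ K := fun y => by
    have hdiff : DifferentiableAt ℝ (deriv v) y :=
      ((contDiff_infty_iff_deriv (𝕜 := ℝ)).1 hv).2.differentiable (by simp) y
    have : deriv a y = ((deriv (deriv v) y : ℝ) : ℂ) := hdiff.hasDerivAt.ofReal_comp.deriv
    rw [this, Complex.norm_real]
    exact (hK₂ y).trans ((le_max_right _ _).trans (le_max_right _ _))
  have har : ∀ y, star (a y) = a y := fun y => Complex.conj_ofReal _
  obtain ⟨C, hC0, hC⟩ := exists_weakImage_component ha hKa hKa' hK1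
  set q := meanCoeff t₀ f₀ f₁ with hq
  set γ : ℝ → Fin 5 → ℝ := fun τ k => antideriv (fun τ => conjCoeff f₀ f₁ τ k - q k) τ with hγ
  have hcont := continuous_conjCoeff hf₀ hf₁
  have hcont' : ∀ k, Continuous fun τ => conjCoeff f₀ f₁ τ k - q k :=
    fun k => (hcont k).sub continuous_const
  have hper := periodic_conjCoeff hf₀ hf₁ hper₀ hper₁ hmean₀ hmean₁
  have hγper : ∀ k, Function.Periodic (fun τ => γ τ k) t₀ := fun k =>
    periodic_antideriv (hcont' k) (fun τ => by rw [hper τ])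
      (integral_sub_timeAverage ht₀ (hcont k))
  choose Λ' hΛ' using fun k => exists_bound_of_periodic ht₀ (hcont k) fun τ => by rw [hper τ]
  choose Γ' hΓ' using fun k =>
    exists_bound_of_periodic ht₀ (continuous_antideriv (hcont' k)) (hγper k)
  have hΛ0 : ∀ k, 0 ≤ Λ' k := fun k => (abs_nonneg _).trans (hΛ' k 0)
  have hΓ0 : ∀ k, 0 ≤ Γ' k := fun k => (abs_nonneg _).trans (hΓ' k 0)
  set Λ := ∑ k, (Λ' k + |q k|)
  set Γ := ∑ k, Γ' k
  have hΛ : ∀ τ k, |conjCoeff f₀ f₁ τ k| ≤ Λ := fun τ k =>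
    ((hΛ' k τ).trans (le_add_of_nonneg_right (abs_nonneg _))).trans
      (Finset.single_le_sum (f := fun k => Λ' k + |q k|)
        (fun k _ => add_nonneg (hΛ0 k) (abs_nonneg _)) (Finset.mem_univ k))
  have hΛq : ∀ k, |q k| ≤ Λ := fun k => (le_add_of_nonneg_left (hΛ0 k)).trans
      (Finset.single_le_sum (f := fun k => Λ' k + |q k|)
        (fun k _ => add_nonneg (hΛ0 k) (abs_nonneg _)) (Finset.mem_univ k))
  have hΓ : ∀ τ k, |γ τ k| ≤ Γ := fun τ k => (hΓ' k τ).trans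
    (Finset.single_le_sum (f := Γ') (fun k _ => hΓ0 k) (Finset.mem_univ k))
  have hΛ00 : 0 ≤ Λ := (abs_nonneg _).trans (hΛq 0)
  have hΓ00 : 0 ≤ Γ := (abs_nonneg _).trans (hΓ 0 0)
  have hγ0 : ∀ k, γ 0 k = 0 := fun k => antideriv_zero _
  -- With five components, `4 * 5 ^ 2 = 100` from the remainder and `5` from the corrector.
  refine ⟨100 * Λ * Γ * C, 5 * Γ * C, by positivity, by positivity, ?_⟩
  intro ε hε φ ψε ψ hψε hψ t N ht hN
  have hsub : Icc 0 t ⊆ Ici 0 := Icc_subset_Ici_self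
  obtain ⟨M₁, hM₁⟩ := isCompact_Icc.exists_bound_of_continuousOn (hψε.continuousOn.mono hsub)
  obtain ⟨M₂, hM₂⟩ := isCompact_Icc.exists_bound_of_continuousOn (hψ.continuousOn.mono hsub)
  have key := norm_averaged_sub_le denseRange_toState (E := component a ha)
    (inner_component ha har) (fun δ hδ χ => exists_regularizer ha hKa hKa' hδ χ)
    (p := conjCoeff f₀ f₁) (q := q) (γ := γ) hΛ hΛq hΓ
    (fun τ k => hasDerivAt_antideriv (hcont' k) τ) hγ0
    (u := fun s => unwind hv f₀ f₁ (s / ε) (ψε s)) (ψ := ψ) (N := C * N) (E₀ := max M₁ M₂) ht hε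
    (fun s hs => by rw [norm_unwind]; exact (hM₁ s hs).trans (le_max_left _ _))
    (fun s hs => (hM₂ s hs).trans (le_max_right _ _))
    (by simp only [zero_div]; rw [unwind_zero, hψε.initial, hψ.initial])
    (fun χ s hs => (hasDerivWithinAt_inner_unwind hv hf₀ hf₁ hψε χ hs.1).mono hsub)
    (fun χ s hs => by
      have := (hψ.equation χ χ.2 s hs.1).mono hsub
      rw [effective_eq_combination hv ht₀, ← inner_toState, one_div_I] at this
      simpa only [← inner_toState] using this)
    (fun s hs => (hC (ψ s) N (hN s hs)).1) (fun s hs => (hC (ψ s) N (hN s hs)).2)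
  have hN0 : 0 ≤ N := by
    by_contra h
    have := hN 0 ⟨le_rfl, ht⟩
    rw [ENNReal.ofReal_of_nonpos (not_le.1 h).le] at this
    exact not_lt_bot this
  have hcard : ((Fintype.card (Fin 5) : ℕ) : ℝ) = 5 := by simp
  rw [hcard] at key
  constructor
  · refine key.trans ?_
    have h1 : ∑ k, |γ (t / ε) k| ≤ 5 * Γ := by
      refine (Finset.sum_le_sum fun k _ => hΓ (t / ε) k).trans (le_of_eq ?_)
      simp
    have h2 : ε * (C * N) * ∑ k, |γ (t / ε) k| ≤ ε * (C * N) * (5 * Γ) :=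
      mul_le_mul_of_nonneg_left h1 (by positivity)
    linarith
  · rintro ⟨n, hn⟩
    -- At `t = n ε t₀` the fast time is `n t₀`, where the periodic `γ` returns to its value `0` at
    -- the origin.
    have h1 : ∀ k, γ (t / ε) k = 0 := by
      intro k
      have h2 : t / ε = n * t₀ := by rw [hn]; field_simp
      rw [h2]
      exact ((hγper k).nat_mul_eq n).trans (hγ0 k)
    simp only [h1, abs_zero, Finset.sum_const_zero, mul_zero, add_zero] at key
    linarith

/-- Passes from all real `N` strictly above the `H²` norms to their supremum, with slack `η / c` to
keep the inequality strict. If the supremum is infinite the claim is trivial for `c > 0`; the case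
`c = 0` needs `h0` because `0 * ⊤ = 0`. -/
theorem ofReal_le_mul_iSup {ψ : ℝ → State} {t x c : ℝ} (hc : 0 ≤ c)
    (h0 : c = 0 → x = 0)
    (h : ∀ N : ℝ, (∀ s ∈ Icc 0 t, h2Norm (ψ s) < ENNReal.ofReal N) → x ≤ c * N) :
    ENNReal.ofReal x ≤ ENNReal.ofReal c * ⨆ s ∈ Icc 0 t, h2Norm (ψ s) := by
  set S := ⨆ s ∈ Icc 0 t, h2Norm (ψ s) with hS
  rcases hc.eq_or_lt with hc0 | hc0
  · rw [h0 hc0.symm]; simp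
  by_cases htop : S = ⊤
  · rw [htop, ENNReal.mul_top (by simpa using hc0)]
    exact le_top
  · have hle : ∀ s ∈ Icc 0 t, h2Norm (ψ s) ≤ S := fun s hs =>
      le_iSup₂ (f := fun s (_ : s ∈ Icc 0 t) => h2Norm (ψ s)) s hs
    have h1 : x ≤ c * S.toReal := by
      refine le_of_forall_pos_le_add fun η hη => ?_
      have := h (S.toReal + η / c) fun s hs => (hle s hs).trans_lt ?_
      · rwa [mul_add, mul_div_cancel₀ _ hc0.ne'] at this
      · rw [ENNReal.lt_ofReal_iff_toReal_lt htop]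
        have : 0 < η / c := by positivity
        linarith
    calc ENNReal.ofReal x ≤ ENNReal.ofReal (c * S.toReal) := ENNReal.ofReal_le_ofReal h1
      _ = _ := by rw [ENNReal.ofReal_mul hc, ENNReal.ofReal_toReal htop]

end Estimate

end DrivenDirac

end

theorem corollary4p1 (t₀ : ℝ) (ht₀ : 0 < t₀) (f₀ f₁ : ℝ → ℝ)
    (hf₀ : Continuous f₀) (hf₁ : Continuous f₁)
    (hper₀ : Function.Periodic f₀ t₀) (hper₁ : Function.Periodic f₁ t₀)
    (hmean₀ : (∫ τ in (0 : ℝ)..t₀, f₀ τ) = 0) (hmean₁ : (∫ τ in (0 : ℝ)..t₀, f₁ τ) = 0)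
    (v : ℝ → ℝ) (hv : ContDiff ℝ ∞ v)
    (hv' : ∃ K : ℝ, ∀ y, |deriv v y| ≤ K) (hv'' : ∃ K : ℝ, ∀ y, |deriv (deriv v) y| ≤ K) :
    -- the effective Hamiltonian is the time average of `U₋₁* (D · σ) U₋₁`
    (∀ χ : DrivenDirac.Plane → DrivenDirac.Spinor, DrivenDirac.IsTestFunction χ →
      ∀ z : DrivenDirac.Plane,
        DrivenDirac.effective t₀ f₀ f₁ v χ z
          = (1 / t₀) • ∫ τ in (0 : ℝ)..t₀, DrivenDirac.conjugated f₀ f₁ v τ χ z) ∧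
    -- the averaging estimate
    ∃ C : ℝ, ∀ ε : ℝ, 0 < ε → ∀ φ : DrivenDirac.State, DrivenDirac.MemH2 φ →
      ∀ ψε ψ : ℝ → DrivenDirac.State,
        DrivenDirac.IsSolution (DrivenDirac.modulated f₀ f₁ v ε) φ ψε →
        DrivenDirac.IsSolution (fun _ => DrivenDirac.effective t₀ f₀ f₁ v) φ ψ →
        ∀ t : ℝ, 0 ≤ t →
          (t₀ ≤ t ∨ (∃ n : ℕ, t = n * (ε * t₀)) →
            DrivenDirac.averagingError f₀ f₁ v ε t ψε ψ
              ≤ ENNReal.ofReal (C * t * ε) * ⨆ s ∈ Set.Icc 0 t, DrivenDirac.h2Norm (ψ s)) ∧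
          DrivenDirac.averagingError f₀ f₁ v ε t ψε ψ
            ≤ ENNReal.ofReal (C * (t₀ + t) * ε) * ⨆ s ∈ Set.Icc 0 t, DrivenDirac.h2Norm (ψ s) := by
  refine ⟨fun χ hχ z => DrivenDirac.effective_eq_average hv ht₀ hf₀ hf₁ ⟨χ, hχ⟩ z, ?_⟩
  obtain ⟨A, B, hA, hB, hAB⟩ := DrivenDirac.exists_averaging_constants hv ht₀ hf₀ hf₁ hper₀ hper₁
    hmean₀ hmean₁ hv' hv''
  have hBt : B = B / t₀ * t₀ := by field_simp
  have hBt0 : 0 ≤ B / t₀ := by positivity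
  -- `B = (B / t₀) * t₀` is absorbed by `(B / t₀) * t` once `t₀ ≤ t`. The extra `1` makes the
  -- constant positive, so `C * t * ε` vanishes only at `t = 0`, where the error is zero.
  refine ⟨A + B / t₀ + 1, fun ε hε φ _ ψε ψ hψε hψ t ht => ?_⟩
  rw [DrivenDirac.averagingError_eq hv]
  have hest := fun N hN => hAB ε hε φ ψε ψ hψε hψ t N ht hN
  have hpos : ∀ N : ℝ, (∀ s ∈ Icc 0 t, DrivenDirac.h2Norm (ψ s) < ENNReal.ofReal N) → 0 ≤ N := by
    intro N hN
    by_contra h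
    have := hN 0 ⟨le_rfl, ht⟩
    rw [ENNReal.ofReal_of_nonpos (not_le.1 h).le] at this
    exact not_lt_bot this
  have hzero : t = 0 →
      ‖DrivenDirac.unwind hv f₀ f₁ (t / ε) (ψε t) - ψ t‖ = 0 := by
    rintro rfl
    rw [zero_div, DrivenDirac.unwind_zero, hψε.initial, hψ.initial, sub_self, norm_zero]
  refine ⟨fun hcase => ?_, ?_⟩
  · refine DrivenDirac.ofReal_le_mul_iSup (by positivity) (fun h => hzero ?_) fun N hN => ?_
    · have : A + B / t₀ + 1 ≠ 0 := by positivity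
      simpa [this, hε.ne'] using h
    · have hεN : 0 ≤ ε * N := mul_nonneg hε.le (hpos N hN)
      rcases hcase with hcase | hcase
      · refine (hest N hN).1.trans ?_
        have h1 : A * t + B ≤ (A + B / t₀ + 1) * t := by
          nlinarith [mul_le_mul_of_nonneg_left hcase hBt0]
        nlinarith [mul_le_mul_of_nonneg_right h1 hεN]
      · refine ((hest N hN).2 hcase).trans ?_
        have h1 : A * t ≤ (A + B / t₀ + 1) * t := by nlinarith [mul_nonneg hBt0 ht]
        nlinarith [mul_le_mul_of_nonneg_right h1 hεN]
  · refine DrivenDirac.ofReal_le_mul_iSup (by positivity) (fun h => ?_) fun N hN => ?_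
    · have : 0 < (A + B / t₀ + 1) * (t₀ + t) * ε := by positivity
      exact absurd h this.ne'
    · have hεN : 0 ≤ ε * N := mul_nonneg hε.le (hpos N hN)
      refine (hest N hN).1.trans ?_
      have h1 : A * t + B ≤ (A + B / t₀ + 1) * (t₀ + t) := by
        nlinarith [mul_nonneg hBt0 ht, mul_nonneg hA ht₀.le]
      nlinarith [mul_le_mul_of_nonneg_right h1 hεN]
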